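/- Let $d\ge 2$. For $x,y\in\mathbb Z^d$ write $x\sim y$ if $|x-y|_2=1$, and for $\Lambda\subset\mathbb Z^d$ let $E(\Lambda)=\{xy : x,y\in\Lambda,\ x\sim y\}$. For $\Lambda$ finite and $\beta\ge 0$: - $\langle\cdot\rangle_{\Lambda,\beta}$ is the Ising expectation with free boundary condition, i.e. expectation under the probability measure on $\{-1,+1\}^\Lambda$ with weights proportional to $\exp\big(\beta\sum_{xy\in E(\Lambda)}\sigma_x\sigma_y\big)$; $\langle\cdot\rangle^+_{\Lambda,\beta}$ is the Ising expectation with $+$ boundary condition, with weights proportional to $\exp\big(\beta\sum_{xy\in E(\Lambda)}\sigma_x\sigma_y+\beta\sum_{x\in\Lambda,\,y\notin\Lambda,\,x\sim y}\sigma_x\big)$; - $\beta_c:=\inf\{\beta\ge 0:\ m^*(\beta)>0\}$, where $m^*(\beta):=\lim_{\Lambda\nearrow\mathbb Z^d}\langle\sigma_0\rangle^+_{\Lambda,\beta}$; - $\nabla_\Lambda(\beta):=\sup_{x\in\Lambda}\sum_{y,z\in\Lambda}\langle\sigma_x\sigma_y\rangle_{\Lambda,\beta}\langle\sigma_y\sigma_z\rangle_{\Lambda,\beta}\langle\sigma_z\sigma_x\rangle_{\Lambda,\beta}$;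 - $\phi^0_{\Lambda,\beta}$ is the free FK-Ising measure, i.e. the probability measure on $\omega\in\{0,1\}^{E(\Lambda)}$ with weights proportional to $2^{k(\omega)}\prod_{e\in E(\Lambda)}(e^{2\beta}-1)^{\omega_e}$, where $k(\omega)$ is the number of connected components of the graph with vertex set $\Lambda$ and edge set $\{e:\omega_e=1\}$. If $0\in\Lambda$, let $\mathcal C(0)$ be the set of vertices connected to $0$ by edges $e$ with $\omega_e=1$, and let $\mathcal C_e(0)$ be the set of edges $e$ with $\omega_e=1$ having an endpoint in $\mathcal C(0)$. There exists a constant $C>0$, depending only on $d$, such that for every finite $\Lambda\subset\mathbb Z^d$ containing $0$, every event $\mathcal A$ measurable with respect to $\mathcal C_e(0)$, and every $\beta_c/2\le\beta'<\beta\le\beta_c$, $$\big|\phi^0_{\Lambda,\beta}[\mathcal A]-\phi^0_{\Lambda,\beta'}[\mathcal A]\big|\le C\,|\beta-\beta'|\,\sqrt{\nabla_\Lambda(\beta_c)\,\max\big\{\phi^0_{\Lambda,\beta}[\mathcal A],\phi^0_{\Lambda,\beta'}[\mathcal A]\big\}\,\phi^0_{\Lambda,\beta'}\big[|\mathcal C(0)|\big]}.$$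 -/

import Mathlib

open scoped MeasureTheory

noncomputable section

namespace FKIsing

section FiniteGraph

variable {V : Type*} [Fintype V] [DecidableEq V]

/-- Boltzmann weight of a spin configuration `σ ∈ {-1,+1}^V` on the finite graph `G`, with
interaction `J` and external field `h`. Spins are units of `ℤ`, i.e. `±1`. -/
def isingWeight (G : SimpleGraph V) [DecidableRel G.Adj] (J : Sym2 V → ℝ) (h : V → ℝ)
    (σ : V → ℤˣ) : ℝ :=
  Real.exp (∑ e ∈ G.edgeFinset, J e * (((e.map σ).mul : ℤˣ) : ℤ) + ∑ x, h x * ((σ x : ℤˣ) : ℤ))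

/-- Expectation `⟨F(σ)⟩_{G,J,h}` of the Ising model on `G`. -/
def isingExp (G : SimpleGraph V) [DecidableRel G.Adj] (J : Sym2 V → ℝ) (h : V → ℝ)
    (F : (V → ℤˣ) → ℝ) : ℝ :=
  (∑ σ, F σ * isingWeight G J h σ) / ∑ σ, isingWeight G J h σ

/-- The graph on `V` whose edges are the open edges of the percolation configuration `ω`.
A percolation configuration is identified with its set of open edges. -/
def openGraph (ω : Finset (Sym2 V)) : SimpleGraph V :=
  SimpleGraph.fromEdgeSet (ω : Set (Sym2 V))

/-- The vertex cluster `𝒞(o)`. -/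
def vertexCluster (o : V) (ω : Finset (Sym2 V)) : Set V :=
  {x | (openGraph ω).Reachable o x}

open Classical in
/-- The edge cluster `𝒞_e(o)`: the open edges with an endpoint (equivalently, both endpoints)
in the vertex cluster of `o`. -/
def edgeCluster (o : V) (ω : Finset (Sym2 V)) : Finset (Sym2 V) :=
  {e ∈ ω | ∃ x ∈ e, x ∈ vertexCluster o ω}

/-- Free FK-Ising weight `2^{k(ω)} ∏_{e open} (e^{2β} - 1)`, where `k(ω)` is the number of
connected components (isolated vertices included). -/
def fkWeight (β : ℝ) (ω : Finset (Sym2 V)) : ℝ :=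
  2 ^ Nat.card (openGraph ω).ConnectedComponent * (Real.exp (2 * β) - 1) ^ ω.card

/-- Expectation under the free FK-Ising measure `φ⁰_{G,β}`, a probability measure on the
configurations `ω ⊆ E(G)`. -/
def fkExp (G : SimpleGraph V) [DecidableRel G.Adj] (β : ℝ) (f : Finset (Sym2 V) → ℝ) : ℝ :=
  (∑ ω ∈ G.edgeFinset.powerset, f ω * fkWeight β ω) / ∑ ω ∈ G.edgeFinset.powerset, fkWeight β ω

/-- Probability of the event `A` under `φ⁰_{G,β}`. -/
def fkProb (G : SimpleGraph V) [DecidableRel G.Adj] (β : ℝ) (A : Set (Finset (Sym2 V))) : ℝ :=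
  fkExp G β (A.indicator 1)

end FiniteGraph

section Lattice

variable {d : ℕ}

/-- The nearest-neighbour graph on `ℤ^d`: `x ∼ y` iff the Euclidean norm of `x - y` is `1`. -/
def latticeGraph (d : ℕ) : SimpleGraph (Fin d → ℤ) where
  Adj x y := ∑ i, (x i - y i) ^ 2 = 1
  symm := ⟨fun x y h => by
    rw [← h]
    exact Finset.sum_congr rfl fun i _ => by ring⟩
  loopless := ⟨fun x h => by simp at h⟩

instance : DecidableRel (latticeGraph d).Adj :=
  fun x y => inferInstanceAs (Decidable (∑ i, (x i - y i) ^ 2 = 1))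

/-- The graph `(Λ, E(Λ))`. -/
abbrev volumeGraph (Λ : Finset (Fin d → ℤ)) : SimpleGraph Λ :=
  (latticeGraph d).comap Subtype.val

/-- The two-point function `⟨σ_x σ_y⟩_{Λ,β}` of the Ising model with free boundary condition. -/
def twoPoint (Λ : Finset (Fin d → ℤ)) (β : ℝ) (x y : Λ) : ℝ :=
  isingExp (volumeGraph Λ) (fun _ => β) 0 fun σ => ((σ x * σ y : ℤˣ) : ℤ)

/-- The triangle diagram `∇_Λ(β)`. -/
def triangle (Λ : Finset (Fin d → ℤ)) (β : ℝ) : ℝ :=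
  ⨆ x : Λ, ∑ y : Λ, ∑ z : Λ, twoPoint Λ β x y * twoPoint Λ β y z * twoPoint Λ β z x

/-- The field induced on `Λ` by the `+` boundary condition: every neighbour `y ∉ Λ` of `x ∈ Λ`
contributes `β σ_x`. -/
def plusField (Λ : Finset (Fin d → ℤ)) (β : ℝ) (x : Λ) : ℝ :=
  β * ({y | y ∉ Λ ∧ (latticeGraph d).Adj x y} : Set (Fin d → ℤ)).ncard

open Classical in
/-- The magnetisation `⟨σ_0⟩⁺_{Λ,β}` in a finite volume `Λ` (set to `0` if `0 ∉ Λ`). -/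
def plusMag (Λ : Finset (Fin d → ℤ)) (β : ℝ) : ℝ :=
  if h : (0 : Fin d → ℤ) ∈ Λ then
    isingExp (volumeGraph Λ) (fun _ => β) (plusField Λ β) fun σ => ((σ ⟨0, h⟩ : ℤˣ) : ℤ)
  else 0

/-- `m` is the spontaneous magnetisation `m*(β) = ⟨σ_0⟩⁺_β`, the limit of `⟨σ_0⟩⁺_{Λ,β}` as
`Λ ↗ ℤ^d` along finite sets directed by inclusion. -/
def IsSpontaneousMag (d : ℕ) (β m : ℝ) : Prop :=
  Filter.Tendsto (fun Λ : Finset (Fin d → ℤ) => plusMag Λ β) Filter.atTop (nhds m)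

/-- The critical inverse temperature `β_c = inf {β ≥ 0 : m*(β) > 0}`. -/
def betaC (d : ℕ) : ℝ :=
  sInf {β : ℝ | 0 ≤ β ∧ ∃ m, IsSpontaneousMag d β m ∧ 0 < m}

end Lattice

end FKIsing

end

/-! The event depends only on the edge cluster of `0`, so it suffices to compare the laws of that
cluster at the two temperatures, and relative entropy does this. By Edwards–Sokal, the probability
at inverse temperature `s` that the cluster is `K` equals, up to a factor free of `s`, `(e^s sinh
s)^|K| · e^{s(|E_K| - |E|)} · Z(E_K, s) / Z(E, s)`, with `E_K` the edges not touching the cluster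
(`log_clusterProb`). Minus the second derivative of its logarithm is `|K| / sinh² s` plus the energy
variance on `E` minus that on `E_K`. Suppose this is at most `M · |𝒞(0)|`. Taylor expansion at `β'`,
whose linear term averages to zero, bounds the relative entropy by `M/2 · (β - β')²` times the mean
cluster size at `β'` (`relativeEntropy_le`). A Pinsker inequality that retains the factor `max(P,
P')` (`sq_sub_le_entropy`) then gives the square root in the theorem.

The core is `energyVar_sub_le`: removing the edges that touch `𝒞(0)` changes the energy variance by
`O(∇ · |𝒞(0)|)`. Covariances involving a removed edge sum to a bubble diagram, which is at most the
triangle. The other covariances change by an integral, over the couplings of the removed edges, of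
third cumulants of three bonds. By `cumulant_le` such a cumulant is at most a sum of triangle
products, and summing over two of the bonds costs one triangle diagram per removed edge.

`cumulant_le` rests on a percolation expansion of two independent Ising copies, where an edge can be
open only if the bond spins agree. There the covariance with `σ_u σ_v` becomes a sum over
configurations disconnecting `u` from `v` (`pf_sq_mul_cov`). Exploring the cluster of `u` leaves a
free Ising model outside it (`clusterSum_mul`), where Griffiths' and Lebowitz' inequalities apply.

Criticality plays no role: `β_c` could be any positive number, and `β' ≥ β_c/2` only keeps `sinh`
away from `0`. -/

noncomputable section

set_option linter.unusedSectionVars false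

namespace FKIsing

/-! ### Spins, ferromagnetic observables and factorisation over disjoint sets. -/

section Spins

variable {V : Type*}

/-- The real value of the spin at `x`. -/
def spin (σ : V → ℤˣ) (x : V) : ℝ := ((σ x : ℤˣ) : ℤ)

/-- The real value of the product of the two spins at the ends of `e`. -/
def bond (σ : V → ℤˣ) (e : Sym2 V) : ℝ := (((e.map σ).mul : ℤˣ) : ℤ)

@[simp] lemma bond_mk (σ : V → ℤˣ) (x y : V) : bond σ s(x, y) = spin σ x * spin σ y := by
  simp [bond, spin]

lemma spin_mul_self (σ : V → ℤˣ) (x : V) : spin σ x * spin σ x = 1 := by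
  rcases Int.units_eq_one_or (σ x) with h | h <;> simp [spin, h]

lemma spin_sq (σ : V → ℤˣ) (x : V) : spin σ x ^ 2 = 1 := by
  rw [sq, spin_mul_self]

@[simp] lemma spin_mul (σ τ : V → ℤˣ) (x : V) : spin (σ * τ) x = spin σ x * spin τ x := by
  simp [spin]

lemma bond_mul (σ τ : V → ℤˣ) (e : Sym2 V) : bond (σ * τ) e = bond σ e * bond τ e := by
  induction e with | _ x y => simp only [bond_mk, spin_mul]; ring

lemma bond_eq_or (σ : V → ℤˣ) (e : Sym2 V) : bond σ e = 1 ∨ bond σ e = -1 := by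
  unfold bond
  rcases Int.units_eq_one_or (e.map σ).mul with h | h <;> simp [h]

lemma bond_congr {σ τ : V → ℤˣ} {e : Sym2 V} (h : ∀ x ∈ e, σ x = τ x) : bond σ e = bond τ e := by
  induction e with | _ x y => simp [spin, h x (by simp), h y (by simp)]

lemma exp_mul_bond (J : ℝ) (σ : V → ℤˣ) (e : Sym2 V) :
    Real.exp (J * bond σ e) = Real.cosh J + Real.sinh J * bond σ e := by
  rcases bond_eq_or σ e with h | h <;> simp [h, ← sub_eq_add_neg]

/-- Nonnegative multiples of characters of the spin group. -/
def ferroMonomials (V : Type*) : Submonoid ((V → ℤˣ) → ℝ) where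
  carrier := {F | ∃ c : ℝ, 0 ≤ c ∧ ∃ χ : (V → ℤˣ) →* ℤˣ, F = fun σ => c * ((χ σ : ℤˣ) : ℤ)}
  one_mem' := ⟨1, zero_le_one, 1, by ext; simp⟩
  mul_mem' := by
    rintro _ _ ⟨c, hc, χ, rfl⟩ ⟨c', hc', χ', rfl⟩
    refine ⟨c * c', mul_nonneg hc hc', χ * χ', ?_⟩
    ext σ
    simp only [Pi.mul_apply, MonoidHom.mul_apply, Units.val_mul, Int.cast_mul]
    ring

/-- The functions of the spins that are nonnegative combinations of spin monomials. -/
def ferro (V : Type*) : Subsemiring ((V → ℤˣ) → ℝ) := (ferroMonomials V).subsemiringClosure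

lemma ferroMonomials_le {F : (V → ℤˣ) → ℝ} (h : F ∈ ferroMonomials V) : F ∈ ferro V :=
  (Submonoid.subsemiringClosure_mem _).2 (AddSubmonoid.subset_closure h)

lemma const_mem_ferro {c : ℝ} (hc : 0 ≤ c) : (fun _ => c) ∈ ferro V :=
  ferroMonomials_le ⟨c, hc, 1, by simp⟩

lemma spin_mem_ferro (x : V) : (fun σ => spin σ x) ∈ ferro V :=
  ferroMonomials_le ⟨1, zero_le_one, Pi.evalMonoidHom _ x, by ext; simp [spin]⟩

lemma mul_mem_ferro {F G : (V → ℤˣ) → ℝ} (hF : F ∈ ferro V) (hG : G ∈ ferro V) :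
    (fun σ => F σ * G σ) ∈ ferro V := (ferro V).mul_mem hF hG

lemma add_mem_ferro {F G : (V → ℤˣ) → ℝ} (hF : F ∈ ferro V) (hG : G ∈ ferro V) :
    (fun σ => F σ + G σ) ∈ ferro V := (ferro V).add_mem hF hG

lemma bond_mem_ferro (e : Sym2 V) : (fun σ => bond σ e) ∈ ferro V := by
  induction e with | _ x y => simpa using mul_mem_ferro (spin_mem_ferro x) (spin_mem_ferro y)

lemma prod_mem_ferro {ι : Type*} (s : Finset ι) {F : ι → (V → ℤˣ) → ℝ}
    (h : ∀ i ∈ s, F i ∈ ferro V) : (fun σ => ∏ i ∈ s, F i σ) ∈ ferro V := by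
  have := (ferro V).prod_mem h
  convert this using 1
  ext σ; simp

variable [Fintype V] [DecidableEq V]

/-- Griffiths' first inequality in algebraic form: a nontrivial character sums to zero, by
translating by an element where it is `-1`, and the trivial one has a positive sum. -/
lemma sum_nonneg_of_mem_ferro {F : (V → ℤˣ) → ℝ} (h : F ∈ ferro V) : 0 ≤ ∑ σ, F σ := by
  replace h := (Submonoid.subsemiringClosure_mem _).1 h
  induction h using AddSubmonoid.closure_induction with
  | mem F hF =>
    obtain ⟨c, hc, χ, rfl⟩ := hF
    rw [← Finset.mul_sum]
    refine mul_nonneg hc ?_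
    by_cases hχ : χ = 1
    · subst hχ; simp
    · obtain ⟨a, ha⟩ : ∃ a, χ a ≠ 1 := by
        by_contra! hcon
        exact hχ (MonoidHom.ext hcon)
      have ha' : χ a = -1 := (Int.units_eq_one_or _).resolve_left ha
      have := Equiv.sum_comp (Equiv.mulLeft a) fun σ => (((χ σ : ℤˣ) : ℤ) : ℝ)
      simp only [Equiv.coe_mulLeft, map_mul, ha', Units.val_neg, Int.cast_neg, neg_mul,
        one_mul, Finset.sum_neg_distrib] at this
      linarith
  | zero => simp
  | add F G hF hG ihF ihG =>
    simp only [Pi.add_apply, Finset.sum_add_distrib]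
    exact add_nonneg ihF ihG

/-- Functions depending on disjoint sets of coordinates are uncorrelated under counting measure. -/
lemma card_mul_sum_mul_of_dependsOn {α : Type*} [Fintype α] (S : Set V) {g h : (V → α) → ℝ}
    (hg : DependsOn g S) (hh : DependsOn h Sᶜ) :
    (Fintype.card (V → α) : ℝ) * ∑ σ, g σ * h σ = (∑ σ, g σ) * ∑ σ, h σ := by
  classical
  -- Two copies exchange their coordinates outside `S`. This preserves the double sum and turns `g σ
  -- * h ρ` into `g σ * h σ`.
  have hinv : Function.Involutive
      (fun p : (V → α) × (V → α) => (S.piecewise p.1 p.2, S.piecewise p.2 p.1)) := by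
    rintro ⟨σ, ρ⟩
    ext x <;> by_cases hx : x ∈ S <;> simp [hx]
  have key := Equiv.sum_comp hinv.toPerm (fun p : (V → α) × (V → α) => g p.1 * h p.2)
  rw [Finset.sum_mul_sum, ← Fintype.sum_prod_type', ← key, Fintype.sum_prod_type]
  have : ∀ σ ρ : V → α, g (S.piecewise σ ρ) * h (S.piecewise ρ σ) = g σ * h σ := by
    intro σ ρ
    congr 1
    · exact hg fun i hi => by simp [hi]
    · exact hh fun i hi => by simp only [Set.mem_compl_iff] at hi; simp [hi]
  simp only [Function.Involutive.coe_toPerm, this]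
  rw [Finset.mul_sum]
  refine Finset.sum_congr rfl fun σ _ => ?_
  simp

end Spins

/-! ### Two-copy percolation, switching, and the Griffiths and Lebowitz inequalities. -/

section Correlations

variable {V : Type*} [Fintype V] [DecidableEq V]

/-- Boltzmann weight with couplings `J`, absent edges having coupling `0`. -/
def boltz (J : Sym2 V → ℝ) (σ : V → ℤˣ) : ℝ := Real.exp (∑ e, J e * bond σ e)

/-- Partition function. -/
def pf (J : Sym2 V → ℝ) : ℝ := ∑ σ, boltz J σ

/-- Expectation. -/
def av (J : Sym2 V → ℝ) (F : (V → ℤˣ) → ℝ) : ℝ := (∑ σ, F σ * boltz J σ) / pf J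

/-- Two-point function. -/
def corr (J : Sym2 V → ℝ) (x y : V) : ℝ := av J fun σ => spin σ x * spin σ y

lemma boltz_pos (J : Sym2 V → ℝ) (σ : V → ℤˣ) : 0 < boltz J σ := Real.exp_pos _

lemma pf_pos (J : Sym2 V → ℝ) : 0 < pf J :=
  Finset.sum_pos (fun σ _ => boltz_pos J σ) ⟨1, Finset.mem_univ _⟩

lemma pf_mul_av (J : Sym2 V → ℝ) (F : (V → ℤˣ) → ℝ) : pf J * av J F = ∑ σ, F σ * boltz J σ := by
  rw [av, mul_div_cancel₀ _ (pf_pos J).ne']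

lemma corr_comm (J : Sym2 V → ℝ) (x y : V) : corr J x y = corr J y x := by
  simp only [corr, mul_comm]

lemma av_one (J : Sym2 V → ℝ) : av J (fun _ => 1) = 1 := by
  simp only [av, one_mul]
  exact div_self (pf_pos J).ne'

lemma corr_self (J : Sym2 V → ℝ) (x : V) : corr J x x = 1 := by
  simp only [corr, spin_mul_self, av_one]

lemma boltz_mem_ferro {J : Sym2 V → ℝ} (hJ : 0 ≤ J) : boltz J ∈ ferro V := by
  have : boltz J = fun σ => ∏ e, Real.exp (J e * bond σ e) := by
    ext σ; rw [boltz, Real.exp_sum]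
  rw [this]
  refine prod_mem_ferro _ fun e _ => ?_
  simp only [exp_mul_bond]
  exact add_mem_ferro (const_mem_ferro (Real.cosh_pos _).le)
    (mul_mem_ferro (const_mem_ferro (Real.sinh_nonneg_iff.2 (hJ e))) (bond_mem_ferro e))

lemma av_nonneg {J : Sym2 V → ℝ} (hJ : 0 ≤ J) {F : (V → ℤˣ) → ℝ} (hF : F ∈ ferro V) :
    0 ≤ av J F :=
  div_nonneg (sum_nonneg_of_mem_ferro (mul_mem_ferro hF (boltz_mem_ferro hJ))) (pf_pos J).le

lemma pair_mem_ferro (x y : V) : (fun σ => spin σ x * spin σ y) ∈ ferro V :=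
  mul_mem_ferro (spin_mem_ferro x) (spin_mem_ferro y)

lemma corr_nonneg {J : Sym2 V → ℝ} (hJ : 0 ≤ J) (x y : V) : 0 ≤ corr J x y :=
  av_nonneg hJ (pair_mem_ferro x y)

/-- Weight of an edge in the percolation representation of two independent Ising copies; it
vanishes unless the bond spins agree. -/
def pairFactor (J : Sym2 V → ℝ) (σ σ' : V → ℤˣ) (e : Sym2 V) : ℝ :=
  Real.exp (J e * (bond σ e + bond σ' e)) - 1

/-- Weight of the percolation configuration `ω` with the observable `F` of the first copy. -/
def pairWeight (J : Sym2 V → ℝ) (F : (V → ℤˣ) → ℝ) (ω : Finset (Sym2 V)) : ℝ :=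
  ∑ σ, ∑ σ', F σ * ∏ e ∈ ω, pairFactor J σ σ' e

lemma boltz_mul_boltz (J : Sym2 V → ℝ) (σ σ' : V → ℤˣ) :
    boltz J σ * boltz J σ' = ∏ e, (1 + pairFactor J σ σ' e) := by
  simp only [boltz, pairFactor, add_sub_cancel, ← Real.exp_add, ← Finset.sum_add_distrib,
    ← Real.exp_sum, mul_add]

lemma boltz_mul_boltz_eq_sum (J : Sym2 V → ℝ) (σ σ' : V → ℤˣ) :
    boltz J σ * boltz J σ' = ∑ ω, ∏ e ∈ ω, pairFactor J σ σ' e := by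
  rw [boltz_mul_boltz, Finset.prod_one_add, Finset.powerset_univ]

lemma pf_sq_mul_av (J : Sym2 V → ℝ) (F : (V → ℤˣ) → ℝ) :
    pf J ^ 2 * av J F = ∑ ω, pairWeight J F ω := by
  have : pf J ^ 2 * av J F = (pf J * av J F) * pf J := by ring
  rw [this, pf_mul_av, pf, Finset.sum_mul_sum]
  simp only [pairWeight]
  rw [Finset.sum_comm]
  simp_rw [mul_assoc, boltz_mul_boltz_eq_sum, Finset.mul_sum]
  rw [Finset.sum_comm (s := (Finset.univ : Finset (Finset (Sym2 V))))]
  rw [Finset.sum_comm]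
  refine Finset.sum_congr rfl fun σ _ => ?_
  rw [Finset.sum_comm]

/-- A single `pairFactor` may be negative, so positivity only appears after summation. Writing `σ' =
σ τ` and fixing `τ`, each factor is either zero or `(cosh 2J - 1) + sinh 2J · σ_e`, which is
ferromagnetic in `σ`. -/
lemma pairWeight_nonneg {J : Sym2 V → ℝ} (hJ : 0 ≤ J) {F : (V → ℤˣ) → ℝ} (hF : F ∈ ferro V)
    (ω : Finset (Sym2 V)) : 0 ≤ pairWeight J F ω := by
  have : pairWeight J F ω = ∑ τ, ∑ σ, F σ * ∏ e ∈ ω, pairFactor J σ (σ * τ) e := by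
    rw [Finset.sum_comm]
    exact Finset.sum_congr rfl fun σ _ =>
      (Equiv.sum_comp (Equiv.mulLeft σ) fun σ' => F σ * ∏ e ∈ ω, pairFactor J σ σ' e).symm
  rw [this]
  refine Finset.sum_nonneg fun τ _ => sum_nonneg_of_mem_ferro
    (mul_mem_ferro hF (prod_mem_ferro _ fun e _ => ?_))
  rcases bond_eq_or τ e with h | h
  · have : (fun σ => pairFactor J σ (σ * τ) e) =
        fun σ => (Real.cosh (2 * J e) - 1) + Real.sinh (2 * J e) * bond σ e := by
      ext σ
      have : J e * (bond σ e + bond σ e * 1) = 2 * J e * bond σ e := by ring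
      rw [pairFactor, bond_mul, h, this, exp_mul_bond]; ring
    rw [this]
    exact add_mem_ferro (const_mem_ferro (sub_nonneg.2 (Real.one_le_cosh _)))
      (mul_mem_ferro (const_mem_ferro (Real.sinh_nonneg_iff.2
        (mul_nonneg zero_le_two (hJ e))))
        (bond_mem_ferro e))
  · have : (fun σ => pairFactor J σ (σ * τ) e) = fun _ => (0 : ℝ) := by
      ext σ
      simp [pairFactor, bond_mul, h]
    rw [this]
    exact const_mem_ferro le_rfl

lemma pairFactor_eq_zero {J : Sym2 V → ℝ} {σ σ' : V → ℤˣ} {e : Sym2 V}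
    (h : bond σ e ≠ bond σ' e) : pairFactor J σ σ' e = 0 := by
  rcases bond_eq_or σ e with h1 | h1 <;> rcases bond_eq_or σ' e with h2 | h2 <;>
    simp_all [pairFactor]

/-- Telescoping along an open path expresses the pair product through bond spins, on which the two
copies agree. -/
lemma spin_pair_eq_of_reachable {σ σ' : V → ℤˣ} {ω : Finset (Sym2 V)}
    (h : ∀ e ∈ ω, bond σ e = bond σ' e) {u v : V} (huv : (openGraph ω).Reachable u v) :
    spin σ u * spin σ v = spin σ' u * spin σ' v := by
  obtain ⟨p⟩ := huv
  induction p with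
  | nil => simp [spin_mul_self]
  | @cons a b c hab p ih =>
    have hb : bond σ s(a, b) = bond σ' s(a, b) :=
      h _ (by simpa using ((SimpleGraph.fromEdgeSet_adj _).1 hab).1)
    rw [bond_mk, bond_mk] at hb
    calc spin σ a * spin σ c
        = (spin σ a * spin σ b) * (spin σ b * spin σ c) := by
          linear_combination - spin σ a * spin σ c * spin_mul_self σ b
      _ = (spin σ' a * spin σ' b) * (spin σ' b * spin σ' c) := by rw [hb, ih]
      _ = spin σ' a * spin σ' c := by
          linear_combination spin σ' a * spin σ' c * spin_mul_self σ' b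

lemma mem_vertexCluster_of_mem_edge {o x y : V} {ω : Finset (Sym2 V)} (he : s(x, y) ∈ ω)
    (hx : x ∈ vertexCluster o ω) : y ∈ vertexCluster o ω := by
  by_cases hxy : x = y
  · exact hxy ▸ hx
  · exact SimpleGraph.Reachable.trans hx
      (SimpleGraph.Adj.reachable ((SimpleGraph.fromEdgeSet_adj _).2 ⟨by simpa using he, hxy⟩))

/-- Flipping the spins of a set. -/
def flip (S : Set V) (x : V) : ℤˣ := by
  classical exact if x ∈ S then -1 else 1

lemma spin_flip_of_mem {S : Set V} {x : V} (h : x ∈ S) : spin (flip S) x = -1 := by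
  simp [spin, flip, h]

lemma spin_flip_of_notMem {S : Set V} {x : V} (h : x ∉ S) : spin (flip S) x = 1 := by
  simp [spin, flip, h]

/-- No open edge leaves a cluster, so flipping a whole cluster in one copy preserves all weights of
open edges. -/
lemma bond_flip_vertexCluster {o : V} {ω : Finset (Sym2 V)} {e : Sym2 V} (he : e ∈ ω) :
    bond (flip (vertexCluster o ω)) e = 1 := by
  induction e with | _ x y =>
  by_cases hx : x ∈ vertexCluster o ω
  · simp [spin_flip_of_mem hx, spin_flip_of_mem (mem_vertexCluster_of_mem_edge he hx)]
  · have hy : y ∉ vertexCluster o ω := fun hy =>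
      hx (mem_vertexCluster_of_mem_edge (Sym2.eq_swap ▸ he) hy)
    simp [spin_flip_of_notMem hx, spin_flip_of_notMem hy]

open Classical in
/-- Switching: the second copy's pair observable becomes a connectivity indicator. -/
lemma sum_pair_mul_prod_pairFactor (J : Sym2 V → ℝ) (F : (V → ℤˣ) → ℝ) (u v : V)
    (ω : Finset (Sym2 V)) :
    ∑ σ, ∑ σ', F σ * (spin σ u * spin σ v) * (spin σ' u * spin σ' v) *
        ∏ e ∈ ω, pairFactor J σ σ' e =
      if v ∈ vertexCluster u ω then pairWeight J F ω else 0 := by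
  split_ifs with h
  · refine Finset.sum_congr rfl fun σ _ => Finset.sum_congr rfl fun σ' _ => ?_
    by_cases hb : ∀ e ∈ ω, bond σ e = bond σ' e
    · rw [← spin_pair_eq_of_reachable hb h]
      have h1 := spin_mul_self σ u
      have h2 := spin_mul_self σ v
      have : F σ * (spin σ u * spin σ v) * (spin σ u * spin σ v) =
          F σ * (spin σ u * spin σ u) * (spin σ v * spin σ v) := by ring
      rw [this, h1, h2, mul_one, mul_one]
    · push Not at hb
      obtain ⟨e, he, hne⟩ := hb
      rw [Finset.prod_eq_zero he (pairFactor_eq_zero hne), mul_zero, mul_zero]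
  · refine Finset.sum_eq_zero fun σ _ => ?_
    -- Flipping the cluster of `u` in the second copy alone reverses the sign of `σ'_u σ'_v`,
    -- because `v` is outside the cluster.
    have hflip := Equiv.sum_comp (Equiv.mulLeft (flip (vertexCluster u ω))) fun σ' =>
      F σ * (spin σ u * spin σ v) * (spin σ' u * spin σ' v) * ∏ e ∈ ω, pairFactor J σ σ' e
    have hu : u ∈ vertexCluster u ω := SimpleGraph.Reachable.refl u
    have hprod : ∀ σ', ∏ e ∈ ω, pairFactor J σ (flip (vertexCluster u ω) * σ') e =
        ∏ e ∈ ω, pairFactor J σ σ' e := fun σ' =>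
      Finset.prod_congr rfl fun e he => by
        simp only [pairFactor, bond_mul, bond_flip_vertexCluster he, one_mul]
    simp only [Equiv.coe_mulLeft, spin_mul, spin_flip_of_mem hu, spin_flip_of_notMem h, hprod,
      neg_mul, mul_neg, one_mul, Finset.sum_neg_distrib] at hflip
    linarith

open Classical in
lemma pf_sq_mul_av_mul_corr (J : Sym2 V → ℝ) (F : (V → ℤˣ) → ℝ) (u v : V) :
    pf J ^ 2 * (av J (fun σ => F σ * (spin σ u * spin σ v)) * corr J u v) =
      ∑ ω, if v ∈ vertexCluster u ω then pairWeight J F ω else 0 := by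
  simp only [← sum_pair_mul_prod_pairFactor]
  have : pf J ^ 2 * (av J (fun σ => F σ * (spin σ u * spin σ v)) * corr J u v) =
      (pf J * av J (fun σ => F σ * (spin σ u * spin σ v))) * (pf J * corr J u v) := by ring
  rw [this, corr, pf_mul_av, pf_mul_av, Finset.sum_mul_sum]
  have hterm : ∀ σ σ' : V → ℤˣ, F σ * (spin σ u * spin σ v) * boltz J σ *
      (spin σ' u * spin σ' v * boltz J σ') = ∑ ω : Finset (Sym2 V),
        F σ * (spin σ u * spin σ v) * (spin σ' u * spin σ' v) *
        ∏ e ∈ ω, pairFactor J σ σ' e := by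
    intro σ σ'
    rw [← Finset.mul_sum, ← boltz_mul_boltz_eq_sum]; ring
  simp_rw [hterm]
  rw [Finset.sum_comm (s := (Finset.univ : Finset (Finset (Sym2 V))))]
  refine Finset.sum_congr rfl fun σ _ => ?_
  rw [Finset.sum_comm]

open Classical in
/-- Truncated correlation as a sum over configurations in which `u` and `v` are disconnected. -/
lemma pf_sq_mul_cov (J : Sym2 V → ℝ) (F : (V → ℤˣ) → ℝ) (u v : V) :
    pf J ^ 2 * (av J (fun σ => F σ * (spin σ u * spin σ v)) - av J F * corr J u v) =
      ∑ ω, if v ∈ vertexCluster u ω then 0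
        else pairWeight J (fun σ => F σ * (spin σ u * spin σ v)) ω := by
  have h := pf_sq_mul_av_mul_corr J (fun σ => F σ * (spin σ u * spin σ v)) u v
  have hF : (fun σ => F σ * (spin σ u * spin σ v) * (spin σ u * spin σ v)) = F := by
    ext σ
    linear_combination F σ * spin σ v ^ 2 * spin_sq σ u + F σ * spin_sq σ v
  rw [hF] at h
  rw [mul_sub, pf_sq_mul_av, h, ← Finset.sum_sub_distrib]
  exact Finset.sum_congr rfl fun ω _ => by split_ifs <;> simp

/-- Griffiths' second inequality: by `pf_sq_mul_cov` the covariance is a sum of nonnegative weights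
over configurations separating `u` from `v`. -/
lemma av_mul_corr_le {J : Sym2 V → ℝ} (hJ : 0 ≤ J) {F : (V → ℤˣ) → ℝ} (hF : F ∈ ferro V)
    (u v : V) : av J F * corr J u v ≤ av J (fun σ => F σ * (spin σ u * spin σ v)) := by
  classical
  have h := pf_sq_mul_cov J F u v
  have h' : 0 ≤ pf J ^ 2 *
      (av J (fun σ => F σ * (spin σ u * spin σ v)) - av J F * corr J u v) := by
    rw [h]
    refine Finset.sum_nonneg fun ω _ => ?_
    split_ifs
    · rfl
    · exact pairWeight_nonneg hJ (mul_mem_ferro hF (pair_mem_ferro u v)) ω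
  exact sub_nonneg.1 (nonneg_of_mul_nonneg_right h' (pow_pos (pf_pos J) 2))

lemma corr_mul_corr_le {J : Sym2 V → ℝ} (hJ : 0 ≤ J) (x y z : V) :
    corr J x y * corr J y z ≤ corr J x z := by
  refine (av_mul_corr_le hJ (pair_mem_ferro x y) y z).trans_eq ?_
  refine congrArg (av J) (funext fun σ => ?_)
  linear_combination spin σ x * spin σ z * spin_sq σ y

/-- The four-point function. -/
def corr4 (J : Sym2 V → ℝ) (x y z w : V) : ℝ :=
  av J fun σ => spin σ x * spin σ y * (spin σ z * spin σ w)

/-- A configuration in which the cluster of `o` contains an odd number of the sources carries no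
weight. -/
lemma pairWeight_eq_zero {J : Sym2 V → ℝ} {F : (V → ℤˣ) → ℝ} (o : V) (ω : Finset (Sym2 V))
    (hF : ∀ σ, F (flip (vertexCluster o ω) * σ) = - F σ) : pairWeight J F ω = 0 := by
  have hflip := Equiv.sum_comp (Equiv.mulLeft (flip (vertexCluster o ω))) fun σ =>
      ∑ σ', F σ * ∏ e ∈ ω, pairFactor J σ σ' e
  have h2 : ∀ σ, ∑ σ', F (flip (vertexCluster o ω) * σ) *
      ∏ e ∈ ω, pairFactor J (flip (vertexCluster o ω) * σ) σ' e =
      - ∑ σ', F σ * ∏ e ∈ ω, pairFactor J σ σ' e := by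
    intro σ
    rw [← Finset.sum_neg_distrib]
    refine Finset.sum_congr rfl fun σ' _ => ?_
    rw [hF, neg_mul]
    congr 2
    exact Finset.prod_congr rfl fun e he => by
        simp only [pairFactor, bond_mul, bond_flip_vertexCluster he, one_mul]
  simp only [Equiv.coe_mulLeft, h2, Finset.sum_neg_distrib] at hflip
  rw [pairWeight]
  linarith

/-- Lebowitz' inequality in its weak form. -/
lemma corr4_le {J : Sym2 V → ℝ} (hJ : 0 ≤ J) (x y z w : V) :
    corr4 J x y z w ≤ corr J x y * corr J z w + corr J x z * corr J y w +
      corr J x w * corr J y z := by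
  classical
  set F : (V → ℤˣ) → ℝ := fun σ => spin σ x * spin σ y * (spin σ z * spin σ w) with hFdef
  have hF : F ∈ ferro V := mul_mem_ferro (pair_mem_ferro x y) (pair_mem_ferro z w)
  have key : ∀ a b c : V, (∀ σ : V → ℤˣ, F σ = spin σ x * spin σ a * (spin σ b * spin σ c)) →
      pf J ^ 2 * (corr J x a * corr J b c) =
        ∑ ω, if a ∈ vertexCluster x ω then pairWeight J F ω else 0 := by
    intro a b c hF'
    rw [← pf_sq_mul_av_mul_corr J F x a, mul_comm (corr J x a)]
    congr 3
    refine congrArg (av J) (funext fun σ => ?_)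
    rw [hF']
    linear_combination - spin σ b * spin σ c * spin σ a ^ 2 * spin_sq σ x -
      spin σ b * spin σ c * spin_sq σ a
  have h1 := key y z w fun σ => rfl
  have h2 := key z y w fun σ => by simp only [hFdef]; ring
  have h3 := key w y z fun σ => by simp only [hFdef]; ring
  have h0 : pf J ^ 2 * corr4 J x y z w = ∑ ω, pairWeight J F ω := pf_sq_mul_av J F
  refine le_of_mul_le_mul_left ?_ (pow_pos (pf_pos J) 2)
  rw [mul_add, mul_add, h0, h1, h2, h3, ← Finset.sum_add_distrib, ← Finset.sum_add_distrib]
  refine Finset.sum_le_sum fun ω _ => ?_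
  have hpos := pairWeight_nonneg hJ hF ω
  have hx : x ∈ vertexCluster x ω := SimpleGraph.Reachable.refl x
  -- The three products count the configurations joining `x` to `y`, to `z` and to `w`. A
  -- configuration missed by all three has `x` as the only source in its cluster, hence carries no
  -- weight.
  by_cases hy : y ∈ vertexCluster x ω <;> by_cases hz : z ∈ vertexCluster x ω <;>
    by_cases hw : w ∈ vertexCluster x ω <;> simp only [hy, hz, hw, if_true, if_false] <;>
    try linarith
  rw [pairWeight_eq_zero x ω fun σ => by
    simp only [hFdef, spin_mul, spin_flip_of_mem hx, spin_flip_of_notMem hy,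
      spin_flip_of_notMem hz, spin_flip_of_notMem hw]; ring]
  simp

end Correlations

/-! ### Derivatives in the couplings and monotonicity of correlations. -/

section Monotonicity

variable {V : Type*} [Fintype V] [DecidableEq V]

lemma hasDerivAt_boltz (J D : Sym2 V → ℝ) (σ : V → ℤˣ) (t : ℝ) :
    HasDerivAt (fun t : ℝ => boltz (J + t • D) σ)
      (boltz (J + t • D) σ * ∑ e, D e * bond σ e) t := by
  have h : ∀ t : ℝ, boltz (J + t • D) σ =
      Real.exp (∑ e, J e * bond σ e + t * ∑ e, D e * bond σ e) := by
    intro t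
    rw [boltz, Finset.mul_sum, ← Finset.sum_add_distrib]
    congr 1
    exact Finset.sum_congr rfl fun e _ => by
      simp only [Pi.add_apply, Pi.smul_apply, smul_eq_mul]
      ring
  simp only [h]
  have := (((hasDerivAt_id t).mul_const (∑ e, D e * bond σ e)).const_add
    (∑ e, J e * bond σ e)).exp
  simpa using this

lemma hasDerivAt_sum_boltz (J D : Sym2 V → ℝ) (F : (V → ℤˣ) → ℝ) (t : ℝ) :
    HasDerivAt (fun t : ℝ => ∑ σ, F σ * boltz (J + t • D) σ)
      (∑ e, D e * (pf (J + t • D) * av (J + t • D) (fun σ => F σ * bond σ e))) t := by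
  have h := HasDerivAt.fun_sum (u := Finset.univ) fun σ (_ : σ ∈ Finset.univ) =>
    (hasDerivAt_boltz J D σ t).const_mul (F σ)
  refine h.congr_deriv ?_
  simp only [pf_mul_av, Finset.mul_sum]
  rw [Finset.sum_comm]
  exact Finset.sum_congr rfl fun e _ => Finset.sum_congr rfl fun σ _ => by ring

lemma hasDerivAt_pf (J D : Sym2 V → ℝ) (t : ℝ) :
    HasDerivAt (fun t : ℝ => pf (J + t • D))
      (∑ e, D e * (pf (J + t • D) * av (J + t • D) (fun σ => bond σ e))) t := by
  simpa [pf] using hasDerivAt_sum_boltz J D (fun _ => 1) t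

/-- Derivative of an expectation in the couplings. -/
lemma hasDerivAt_av (J D : Sym2 V → ℝ) (F : (V → ℤˣ) → ℝ) (t : ℝ) :
    HasDerivAt (fun t : ℝ => av (J + t • D) F)
      (∑ e, D e * (av (J + t • D) (fun σ => F σ * bond σ e) -
        av (J + t • D) F * av (J + t • D) (fun σ => bond σ e))) t := by
  have hp := (pf_pos (J + t • D)).ne'
  refine ((hasDerivAt_sum_boltz J D F t).div (hasDerivAt_pf J D t) hp).congr_deriv ?_
  rw [← pf_mul_av]
  rw [Finset.sum_mul, Finset.mul_sum, ← Finset.sum_sub_distrib, Finset.sum_div]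
  refine Finset.sum_congr rfl fun e _ => ?_
  field_simp

lemma hasDerivAt_log_pf (J D : Sym2 V → ℝ) (t : ℝ) :
    HasDerivAt (fun t : ℝ => Real.log (pf (J + t • D)))
      (∑ e, D e * av (J + t • D) (fun σ => bond σ e)) t := by
  have hp := (pf_pos (J + t • D)).ne'
  refine ((hasDerivAt_pf J D t).log hp).congr_deriv ?_
  rw [Finset.sum_div]
  refine Finset.sum_congr rfl fun e _ => ?_
  field_simp

lemma av_mul_av_bond_le {J : Sym2 V → ℝ} (hJ : 0 ≤ J) {F : (V → ℤˣ) → ℝ} (hF : F ∈ ferro V)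
    (e : Sym2 V) : av J F * av J (fun σ => bond σ e) ≤ av J (fun σ => F σ * bond σ e) := by
  induction e with | _ x y => simpa [corr] using av_mul_corr_le hJ hF x y

/-- Griffiths' inequality: expectations of ferromagnetic observables increase with the couplings. -/
lemma av_mono {J J' : Sym2 V → ℝ} (hJ : 0 ≤ J) (hJJ' : J ≤ J') {F : (V → ℤˣ) → ℝ}
    (hF : F ∈ ferro V) : av J F ≤ av J' F := by
  have hmono : MonotoneOn (fun t : ℝ => av (J + t • (J' - J)) F) (Set.Icc 0 1) := by
    refine monotoneOn_of_deriv_nonneg (convex_Icc 0 1)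
      (fun t _ => (hasDerivAt_av _ _ _ t).continuousAt.continuousWithinAt)
      (fun t _ => (hasDerivAt_av _ _ _ t).differentiableAt.differentiableWithinAt) fun t ht => ?_
    rw [interior_Icc] at ht
    rw [(hasDerivAt_av _ _ _ t).deriv]
    have hpos : 0 ≤ J + t • (J' - J) := by
      intro e
      have h1 := hJ e
      have h2 := hJJ' e
      simp only [Pi.zero_apply, Pi.add_apply, Pi.smul_apply, Pi.sub_apply, smul_eq_mul] at *
      exact add_nonneg h1 (mul_nonneg ht.1.le (sub_nonneg.2 h2))
    exact Finset.sum_nonneg fun e _ => mul_nonneg (sub_nonneg.2 (hJJ' e))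
      (sub_nonneg.2 (av_mul_av_bond_le hpos hF e))
  have := hmono (Set.left_mem_Icc.2 zero_le_one) (Set.right_mem_Icc.2 zero_le_one) zero_le_one
  simpa using this

lemma corr_mono {J J' : Sym2 V → ℝ} (hJ : 0 ≤ J) (hJJ' : J ≤ J') (x y : V) :
    corr J x y ≤ corr J' x y := av_mono hJ hJJ' (pair_mem_ferro x y)

end Monotonicity

/-! ### Exploration of a cluster and the domain Markov property. -/

section Exploration

variable {V : Type*} [Fintype V] [DecidableEq V]

lemma self_mem_vertexCluster (o : V) (ω : Finset (Sym2 V)) : o ∈ vertexCluster o ω :=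
  SimpleGraph.Reachable.refl o

lemma mem_edgeCluster {o : V} {ω : Finset (Sym2 V)} {e : Sym2 V} :
    e ∈ edgeCluster o ω ↔ e ∈ ω ∧ ∃ x ∈ e, x ∈ vertexCluster o ω := by
  simp [edgeCluster]

lemma vertexCluster_mono {o : V} {ω ω' : Finset (Sym2 V)} (h : ω ⊆ ω') :
    vertexCluster o ω ⊆ vertexCluster o ω' := fun _ hx =>
  SimpleGraph.Reachable.mono (SimpleGraph.fromEdgeSet_mono (by exact_mod_cast h)) hx

/-- A set containing `o` and closed under open edges contains the cluster of `o`. -/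
lemma vertexCluster_subset {o : V} {ω : Finset (Sym2 V)} {S : Set V} (ho : o ∈ S)
    (h : ∀ x y, s(x, y) ∈ ω → x ∈ S → y ∈ S) : vertexCluster o ω ⊆ S := by
  rintro x ⟨p⟩
  induction p with
  | nil => exact ho
  | cons hab p ih => exact ih (h _ _ (by simpa using ((SimpleGraph.fromEdgeSet_adj _).1 hab).1) ho)

lemma mem_vertexCluster_of_mem {o x y : V} {ω : Finset (Sym2 V)} {e : Sym2 V} (he : e ∈ ω)
    (hx : x ∈ e) (hy : y ∈ e) (hxo : x ∈ vertexCluster o ω) : y ∈ vertexCluster o ω := by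
  induction e with | _ a b =>
  rcases Sym2.mem_iff.1 hx with rfl | rfl <;> rcases Sym2.mem_iff.1 hy with rfl | rfl
  · exact hxo
  · exact mem_vertexCluster_of_mem_edge he hxo
  · exact mem_vertexCluster_of_mem_edge (Sym2.eq_swap ▸ he) hxo
  · exact hxo

@[simp] lemma vertexCluster_edgeCluster (o : V) (ω : Finset (Sym2 V)) :
    vertexCluster o (edgeCluster o ω) = vertexCluster o ω := by
  refine (vertexCluster_mono (fun e he => (mem_edgeCluster.1 he).1)).antisymm ?_
  have key : vertexCluster o ω ⊆ vertexCluster o (edgeCluster o ω) ∩ vertexCluster o ω := by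
    refine vertexCluster_subset ⟨self_mem_vertexCluster _ _, self_mem_vertexCluster _ _⟩ ?_
    rintro x y he ⟨hx1, hx2⟩
    exact ⟨mem_vertexCluster_of_mem_edge (mem_edgeCluster.2 ⟨he, x, by simp, hx2⟩) hx1,
      mem_vertexCluster_of_mem_edge he hx2⟩
  exact fun x hx => (key hx).1

@[simp] lemma edgeCluster_edgeCluster (o : V) (ω : Finset (Sym2 V)) :
    edgeCluster o (edgeCluster o ω) = edgeCluster o ω := by
  ext e
  rw [mem_edgeCluster, vertexCluster_edgeCluster]
  exact ⟨fun h => h.1, fun h => ⟨h, (mem_edgeCluster.1 h).2⟩⟩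

open Classical in
/-- The edges with no endpoint in `S`. -/
def edgesOff (S : Set V) : Finset (Sym2 V) := {e | ∀ x ∈ e, x ∉ S}

lemma mem_edgesOff {S : Set V} {e : Sym2 V} : e ∈ edgesOff S ↔ ∀ x ∈ e, x ∉ S := by
  simp [edgesOff]

lemma mem_vertexCluster_of_mem_cluster {o x : V} {K : Finset (Sym2 V)} {e : Sym2 V}
    (hK : edgeCluster o K = K) (he : e ∈ K) (hx : x ∈ e) : x ∈ vertexCluster o K := by
  rw [← hK, mem_edgeCluster] at he
  obtain ⟨he, y, hy, hyo⟩ := he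
  exact mem_vertexCluster_of_mem he hy hx hyo

lemma notMem_edgesOff_of_mem_cluster {o : V} {K : Finset (Sym2 V)} {e : Sym2 V}
    (hK : edgeCluster o K = K) (he : e ∈ K) : e ∉ edgesOff (vertexCluster o K) := by
  rw [mem_edgesOff]
  push Not
  rw [← hK, mem_edgeCluster] at he
  exact he.2

/-- Another open edge touching the vertices of `K` would itself belong to the cluster. Fixing the
cluster thus opens `K`, closes the other edges touching it, and leaves `edgesOff` unconstrained. -/
lemma edgeCluster_eq_iff {o : V} {K ω : Finset (Sym2 V)} (hK : edgeCluster o K = K) :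
    edgeCluster o ω = K ↔ K ⊆ ω ∧ ω \ K ⊆ edgesOff (vertexCluster o K) := by
  constructor
  · rintro rfl
    refine ⟨fun e he => (mem_edgeCluster.1 he).1, fun e he => ?_⟩
    rw [Finset.mem_sdiff, mem_edgeCluster] at he
    rw [vertexCluster_edgeCluster, mem_edgesOff]
    exact fun x hx hxo => he.2 ⟨he.1, x, hx, hxo⟩
  · rintro ⟨h1, h2⟩
    have hS : vertexCluster o ω = vertexCluster o K := by
      refine (vertexCluster_subset (self_mem_vertexCluster _ _) fun x y he hx => ?_).antisymm
        (vertexCluster_mono h1)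
      by_cases heK : s(x, y) ∈ K
      · exact mem_vertexCluster_of_mem_edge heK hx
      · exact absurd hx (mem_edgesOff.1 (h2 (Finset.mem_sdiff.2 ⟨he, heK⟩)) x (by simp))
    ext e
    rw [mem_edgeCluster, hS]
    constructor
    · rintro ⟨he, x, hx, hxo⟩
      by_contra heK
      exact mem_edgesOff.1 (h2 (Finset.mem_sdiff.2 ⟨he, heK⟩)) x hx hxo
    · intro he
      refine ⟨h1 he, ?_⟩
      rw [← hK, mem_edgeCluster] at he
      exact he.2

open Classical in
lemma sum_prod_of_edgeCluster_eq {o : V} {K : Finset (Sym2 V)} (hK : edgeCluster o K = K)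
    (f : Sym2 V → ℝ) :
    ∑ ω with edgeCluster o ω = K, ∏ e ∈ ω, f e =
      (∏ e ∈ K, f e) * ∏ e ∈ edgesOff (vertexCluster o K), (1 + f e) := by
  have hdisj : Disjoint K (edgesOff (vertexCluster o K)) :=
    Finset.disjoint_left.2 fun e he => notMem_edgesOff_of_mem_cluster hK he
  rw [Finset.prod_one_add, Finset.mul_sum]
  refine Finset.sum_bij' (fun ω _ => ω \ K) (fun ω _ => K ∪ ω) ?_ ?_ ?_ ?_ ?_
  · intro ω hω
    exact Finset.mem_powerset.2 ((edgeCluster_eq_iff hK).1 (Finset.mem_filter.1 hω).2).2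
  · intro ω hω
    refine Finset.mem_filter.2 ⟨Finset.mem_univ _, (edgeCluster_eq_iff hK).2
      ⟨Finset.subset_union_left, ?_⟩⟩
    rw [Finset.union_sdiff_left]
    exact Finset.sdiff_subset.trans (Finset.mem_powerset.1 hω)
  · intro ω hω
    exact Finset.union_sdiff_of_subset ((edgeCluster_eq_iff hK).1 (Finset.mem_filter.1 hω).2).1
  · intro ω hω
    rw [Finset.union_sdiff_left]
    exact Finset.sdiff_eq_self_of_disjoint
      (hdisj.mono_right (Finset.mem_powerset.1 hω)).symm
  · intro ω hω
    rw [mul_comm]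
    exact (Finset.prod_sdiff ((edgeCluster_eq_iff hK).1 (Finset.mem_filter.1 hω).2).1).symm

open Classical in
/-- The couplings `J` with those of edges touching `S` set to `0`. -/
def couplingOff (S : Set V) (J : Sym2 V → ℝ) (e : Sym2 V) : ℝ :=
  if e ∈ edgesOff S then J e else 0

lemma couplingOff_nonneg {J : Sym2 V → ℝ} (hJ : 0 ≤ J) (S : Set V) : 0 ≤ couplingOff S J := by
  intro e
  simp only [couplingOff, Pi.zero_apply]
  split_ifs
  · exact hJ e
  · exact le_rfl

lemma couplingOff_le {J : Sym2 V → ℝ} (hJ : 0 ≤ J) (S : Set V) : couplingOff S J ≤ J := by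
  intro e
  simp only [couplingOff]
  split_ifs
  · exact le_rfl
  · exact hJ e

lemma prod_edgesOff_pairFactor (J : Sym2 V → ℝ) (S : Set V) (σ σ' : V → ℤˣ) :
    ∏ e ∈ edgesOff S, (1 + pairFactor J σ σ' e) =
      boltz (couplingOff S J) σ * boltz (couplingOff S J) σ' := by
  rw [boltz_mul_boltz, ← Finset.prod_subset (Finset.subset_univ (edgesOff S))]
  · exact Finset.prod_congr rfl fun e he => by simp [pairFactor, couplingOff, he]
  · intro e _ he
    simp [pairFactor, couplingOff, he]

lemma dependsOn_boltz_couplingOff (J : Sym2 V → ℝ) (S : Set V) :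
    DependsOn (boltz (couplingOff S J)) Sᶜ := by
  intro σ τ h
  rw [boltz, boltz]
  congr 1
  refine Finset.sum_congr rfl fun e _ => ?_
  by_cases he : e ∈ edgesOff S
  · rw [bond_congr fun x hx => h x (mem_edgesOff.1 he x hx)]
  · simp [couplingOff, he]

/-- The single-copy factorisation is used once in each copy, hence the squared cardinality. -/
lemma card_sq_mul_sum_sum_mul {S : Set V} {g h : (V → ℤˣ) → (V → ℤˣ) → ℝ}
    (hg : ∀ σ, DependsOn (g σ) S) (hg' : ∀ σ', DependsOn (fun σ => g σ σ') S)
    (hh : ∀ σ, DependsOn (h σ) Sᶜ) (hh' : ∀ σ', DependsOn (fun σ => h σ σ') Sᶜ) :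
    (Fintype.card (V → ℤˣ) : ℝ) ^ 2 * ∑ σ, ∑ σ', g σ σ' * h σ σ' =
      (∑ σ, ∑ σ', g σ σ') * ∑ σ, ∑ σ', h σ σ' := by
  rw [sq, mul_assoc, Finset.mul_sum]
  simp_rw [fun σ => card_mul_sum_mul_of_dependsOn S (hg σ) (hh σ)]
  refine card_mul_sum_mul_of_dependsOn S ?_ ?_
  · exact fun σ τ hστ => Finset.sum_congr rfl fun σ' _ => hg' σ' hστ
  · exact fun σ τ hστ => Finset.sum_congr rfl fun σ' _ => hh' σ' hστ

open Classical in
/-- Total weight of the configurations in which the edge cluster of `o` is `K`. -/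
def clusterSum (J : Sym2 V → ℝ) (o : V) (F : (V → ℤˣ) → ℝ) (K : Finset (Sym2 V)) : ℝ :=
  ∑ ω with edgeCluster o ω = K, pairWeight J F ω

lemma clusterSum_nonneg {J : Sym2 V → ℝ} (hJ : 0 ≤ J) (o : V) {F : (V → ℤˣ) → ℝ}
    (hF : F ∈ ferro V) (K : Finset (Sym2 V)) : 0 ≤ clusterSum J o F K :=
  Finset.sum_nonneg fun ω _ => pairWeight_nonneg hJ hF ω

lemma clusterSum_eq_zero_of_ne {J : Sym2 V → ℝ} {o : V} {F : (V → ℤˣ) → ℝ}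
    {K : Finset (Sym2 V)} (hK : edgeCluster o K ≠ K) : clusterSum J o F K = 0 := by
  refine Finset.sum_eq_zero fun ω hω => absurd ?_ hK
  rw [← (Finset.mem_filter.1 hω).2, edgeCluster_edgeCluster]

lemma clusterSum_eq_zero_of_flip {J : Sym2 V → ℝ} {o : V} {F : (V → ℤˣ) → ℝ}
    {K : Finset (Sym2 V)} (hF : ∀ σ, F (flip (vertexCluster o K) * σ) = - F σ) :
    clusterSum J o F K = 0 := by
  refine Finset.sum_eq_zero fun ω hω => pairWeight_eq_zero o ω ?_
  rw [← (Finset.mem_filter.1 hω).2, vertexCluster_edgeCluster] at hF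
  exact hF

open Classical in
lemma sum_clusterSum (J : Sym2 V → ℝ) (o : V) (F : (V → ℤˣ) → ℝ) (p : Set V → Prop)
    [DecidablePred p] :
    ∑ K, (if p (vertexCluster o K) then clusterSum J o F K else 0) =
      ∑ ω, if p (vertexCluster o ω) then pairWeight J F ω else 0 := by
  rw [← Finset.sum_fiberwise (s := Finset.univ) (g := edgeCluster o)
    (f := fun ω => if p (vertexCluster o ω) then pairWeight J F ω else 0)]
  refine Finset.sum_congr rfl fun K _ => ?_
  have : ∀ ω ∈ Finset.univ.filter (fun ω => edgeCluster o ω = K),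
      (if p (vertexCluster o ω) then pairWeight J F ω else 0) =
        if p (vertexCluster o K) then pairWeight J F ω else 0 := by
    intro ω hω
    rw [← (Finset.mem_filter.1 hω).2, vertexCluster_edgeCluster]
  rw [Finset.sum_congr rfl this]
  split_ifs
  · rfl
  · simp

/-- Given the cluster, the edges of `K` see only the spins inside it, while the sum over the
unconstrained edges resums to two Boltzmann weights living outside it. -/
lemma card_sq_mul_clusterSum (J : Sym2 V → ℝ) {o : V} {K : Finset (Sym2 V)}
    (hK : edgeCluster o K = K) {F G : (V → ℤˣ) → ℝ} (hF : DependsOn F (vertexCluster o K))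
    (hG : DependsOn G (vertexCluster o K)ᶜ) :
    (Fintype.card (V → ℤˣ) : ℝ) ^ 2 * clusterSum J o (fun σ => F σ * G σ) K =
      pairWeight J F K * (pf (couplingOff (vertexCluster o K) J) ^ 2 *
        av (couplingOff (vertexCluster o K) J) G) := by
  classical
  set S := vertexCluster o K
  have h1 : clusterSum J o (fun σ => F σ * G σ) K = ∑ σ, ∑ σ',
      (F σ * ∏ e ∈ K, pairFactor J σ σ' e) *
        (G σ * (boltz (couplingOff S J) σ * boltz (couplingOff S J) σ')) := by
    simp only [clusterSum, pairWeight]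
    rw [Finset.sum_comm]
    refine Finset.sum_congr rfl fun σ _ => ?_
    rw [Finset.sum_comm]
    refine Finset.sum_congr rfl fun σ' _ => ?_
    rw [← Finset.mul_sum, sum_prod_of_edgeCluster_eq hK, prod_edgesOff_pairFactor]
    ring
  have h2 : pf (couplingOff S J) ^ 2 * av (couplingOff S J) G = ∑ σ, ∑ σ',
      G σ * (boltz (couplingOff S J) σ * boltz (couplingOff S J) σ') := by
    have : pf (couplingOff S J) ^ 2 * av (couplingOff S J) G =
      (pf (couplingOff S J) * av (couplingOff S J) G) * pf (couplingOff S J) := by ring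
    rw [this, pf_mul_av, pf, Finset.sum_mul_sum]
    simp only [mul_assoc]
  rw [h1, h2, pairWeight]
  have hprod : ∀ σ τ σ' τ' : V → ℤˣ, (∀ i ∈ S, σ i = τ i) → (∀ i ∈ S, σ' i = τ' i) →
      ∏ e ∈ K, pairFactor J σ σ' e = ∏ e ∈ K, pairFactor J τ τ' e := by
    intro σ τ σ' τ' h h'
    refine Finset.prod_congr rfl fun e he => ?_
    rw [pairFactor, pairFactor,
      bond_congr fun x hx => h x (mem_vertexCluster_of_mem_cluster hK he hx),
      bond_congr fun x hx => h' x (mem_vertexCluster_of_mem_cluster hK he hx)]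
  refine card_sq_mul_sum_sum_mul (S := S) ?_ ?_ ?_ ?_
  · intro σ σ' τ' h
    simp only [hprod σ σ σ' τ' (fun _ _ => rfl) h]
  · intro σ' σ τ h
    simp only [hprod σ τ σ' σ' h (fun _ _ => rfl), hF h]
  · intro σ σ' τ' h
    simp only [dependsOn_boltz_couplingOff J S h]
  · intro σ' σ τ h
    simp only [dependsOn_boltz_couplingOff J S h, hG h]

/-- Domain Markov property of the two-copy percolation. -/
lemma clusterSum_mul (J : Sym2 V → ℝ) {o : V} {K : Finset (Sym2 V)} {F G : (V → ℤˣ) → ℝ}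
    (hF : DependsOn F (vertexCluster o K)) (hG : DependsOn G (vertexCluster o K)ᶜ) :
    clusterSum J o (fun σ => F σ * G σ) K =
      clusterSum J o F K * av (couplingOff (vertexCluster o K) J) G := by
  by_cases hK : edgeCluster o K = K
  · have hN : (Fintype.card (V → ℤˣ) : ℝ) ^ 2 ≠ 0 := by positivity
    have h1 := card_sq_mul_clusterSum J hK hF hG
    -- The case `G = 1` identifies the common factor, so the partition function outside the cluster
    -- never has to be computed.
    have h2 := card_sq_mul_clusterSum J hK hF (G := fun _ => 1) (fun _ _ _ => rfl)
    rw [av_one] at h2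
    simp only [mul_one] at h2
    refine mul_left_cancel₀ hN ?_
    rw [h1, ← mul_assoc, ← mul_assoc, h2]
  · simp [clusterSum_eq_zero_of_ne hK]

end Exploration

/-! ### Triangle bound on the third cumulant of three bonds. -/

section ThirdCumulant

variable {V : Type*} [Fintype V] [DecidableEq V]

lemma dependsOn_pair {S : Set V} {x y : V} (hx : x ∈ S) (hy : y ∈ S) :
    DependsOn (fun σ : V → ℤˣ => spin σ x * spin σ y) S := by
  intro σ τ h
  simp only [spin, h x hx, h y hy]

lemma dependsOn_quad {S : Set V} {x y z w : V} (hx : x ∈ S) (hy : y ∈ S) (hz : z ∈ S)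
    (hw : w ∈ S) :
    DependsOn (fun σ : V → ℤˣ => spin σ x * spin σ y * (spin σ z * spin σ w)) S := by
  intro σ τ h
  simp only [spin, h x hx, h y hy, h z hz, h w hw]

lemma quad_mem_ferro (x y z w : V) :
    (fun σ => spin σ x * spin σ y * (spin σ z * spin σ w)) ∈ ferro V :=
  mul_mem_ferro (pair_mem_ferro x y) (pair_mem_ferro z w)

/-- The six-spin observable. -/
def sext (x y z w u v : V) (σ : V → ℤˣ) : ℝ :=
  spin σ x * spin σ y * (spin σ z * spin σ w) * (spin σ u * spin σ v)

open Classical in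
/-- The weight of the configurations with edge cluster `K` at `u` and sources `u, a`, if `a` is in
the cluster. -/
def linkSum (J : Sym2 V → ℝ) (u a : V) (K : Finset (Sym2 V)) : ℝ :=
  if a ∈ vertexCluster u K then clusterSum J u (fun σ => spin σ u * spin σ a) K else 0

open Classical in
/-- The weight of the configurations with edge cluster `K` at `u` and sources `u, a, b, c`, if
`a, b, c` are in the cluster. -/
def linkSum₃ (J : Sym2 V → ℝ) (u a b c : V) (K : Finset (Sym2 V)) : ℝ :=
  if a ∈ vertexCluster u K ∧ b ∈ vertexCluster u K ∧ c ∈ vertexCluster u K then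
    clusterSum J u (fun σ => spin σ u * spin σ a * (spin σ b * spin σ c)) K else 0

lemma linkSum_nonneg {J : Sym2 V → ℝ} (hJ : 0 ≤ J) (u a : V) (K : Finset (Sym2 V)) :
    0 ≤ linkSum J u a K := by
  rw [linkSum]
  split_ifs
  · exact clusterSum_nonneg hJ u (pair_mem_ferro u a) K
  · exact le_rfl

lemma linkSum₃_nonneg {J : Sym2 V → ℝ} (hJ : 0 ≤ J) (u a b c : V) (K : Finset (Sym2 V)) :
    0 ≤ linkSum₃ J u a b c K := by
  rw [linkSum₃]
  split_ifs
  · exact clusterSum_nonneg hJ u (quad_mem_ferro u a b c) K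
  · exact le_rfl

lemma sum_linkSum_le {J : Sym2 V → ℝ} (hJ : 0 ≤ J) (u a : V) :
    ∑ K, linkSum J u a K ≤ pf J ^ 2 * corr J u a := by
  classical
  have h := sum_clusterSum J u (fun σ => spin σ u * spin σ a) (fun S => a ∈ S)
  simp only [linkSum]
  rw [h, corr, pf_sq_mul_av]
  refine Finset.sum_le_sum fun ω _ => ?_
  split_ifs
  · exact le_rfl
  · exact pairWeight_nonneg hJ (pair_mem_ferro u a) ω

/-- When `b` and `c` both lie in the cluster of `u` they are connected, so switching on the pair `b,
c` splits the four-source weight into two correlations. -/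
lemma sum_linkSum₃_le {J : Sym2 V → ℝ} (hJ : 0 ≤ J) (u a b c : V) :
    ∑ K, linkSum₃ J u a b c K ≤ pf J ^ 2 * (corr J u a * corr J b c) := by
  classical
  have h := sum_clusterSum J u (fun σ => spin σ u * spin σ a * (spin σ b * spin σ c))
    (fun S => a ∈ S ∧ b ∈ S ∧ c ∈ S)
  have h2 := pf_sq_mul_av_mul_corr J
    (fun σ => spin σ u * spin σ a * (spin σ b * spin σ c)) b c
  have h3 : (fun σ : V → ℤˣ => spin σ u * spin σ a * (spin σ b * spin σ c) *
      (spin σ b * spin σ c)) = fun σ => spin σ u * spin σ a := by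
    ext σ
    linear_combination spin σ u * spin σ a * spin σ c ^ 2 * spin_sq σ b +
      spin σ u * spin σ a * spin_sq σ c
  rw [h3] at h2
  simp only [linkSum₃]
  rw [h, corr, h2]
  refine Finset.sum_le_sum fun ω _ => ?_
  have hpos := pairWeight_nonneg hJ (quad_mem_ferro u a b c) ω
  split_ifs with h4 h5 h5
  · exact le_rfl
  · exact absurd (SimpleGraph.Reachable.trans (SimpleGraph.Reachable.symm h4.2.1) h4.2.2) h5
  · exact hpos
  · exact le_rfl

/-- The contribution of clusters containing exactly one source besides `u`. -/
lemma clusterSum_sext_of_one {J : Sym2 V → ℝ} (hJ : 0 ≤ J) {u v x y z w : V}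
    {K : Finset (Sym2 V)} (hv : v ∉ vertexCluster u K) (hx : x ∈ vertexCluster u K)
    (hy : y ∉ vertexCluster u K) (hz : z ∉ vertexCluster u K) (hw : w ∉ vertexCluster u K) :
    clusterSum J u (sext x y z w u v) K - corr J z w *
        clusterSum J u (fun σ => spin σ x * spin σ y * (spin σ u * spin σ v)) K ≤
      linkSum J u x K * (corr J y z * corr J w v + corr J y w * corr J z v) := by
  have hu := self_mem_vertexCluster u K
  set S := vertexCluster u K with hS
  have h6 : sext x y z w u v =
      fun σ => (spin σ u * spin σ x) * (spin σ y * spin σ v * (spin σ z * spin σ w)) := by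
    ext σ; simp only [sext]; ring
  have h4 : (fun σ : V → ℤˣ => spin σ x * spin σ y * (spin σ u * spin σ v)) =
      fun σ => (spin σ u * spin σ x) * (spin σ y * spin σ v) := by
    ext σ; ring
  rw [h6, h4, clusterSum_mul J (dependsOn_pair hu hx) (dependsOn_quad hy hv hz hw),
    clusterSum_mul J (dependsOn_pair hu hx) (dependsOn_pair hy hv), linkSum, if_pos hx]
  have hJ' := couplingOff_nonneg hJ S
  have hle := couplingOff_le hJ S
  set J' := couplingOff S J
  have hL := corr4_le hJ' y v z w
  have hT := clusterSum_nonneg hJ u (pair_mem_ferro u x) K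
  have m := fun a b => corr_mono hJ' hle a b
  have n := fun a b => corr_nonneg hJ' a b
  have n' := fun a b => corr_nonneg hJ a b
  -- This is the one Lebowitz pairing that is not part of a triangle; it is absorbed by the
  -- subtracted term of the cumulant.
  have e1 : corr J' y v * corr J' z w ≤ corr J' y v * corr J z w :=
    mul_le_mul_of_nonneg_left (m z w) (n y v)
  have e2 : corr J' y z * corr J' v w ≤ corr J y z * corr J w v := by
    rw [corr_comm J w v]
    exact mul_le_mul (m y z) (m v w) (n v w) (n' y z)
  have e3 : corr J' y w * corr J' v z ≤ corr J y w * corr J z v := by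
    rw [corr_comm J z v]
    exact mul_le_mul (m y w) (m v z) (n v z) (n' y w)
  have key : corr4 J' y v z w - corr J z w * corr J' y v ≤
      corr J y z * corr J w v + corr J y w * corr J z v := by linarith
  calc _ = clusterSum J u (fun σ => spin σ u * spin σ x) K *
        (corr4 J' y v z w - corr J z w * corr J' y v) := by
        simp only [corr4, corr]; ring
    _ ≤ _ := mul_le_mul_of_nonneg_left key hT

/-- The contribution of clusters containing all sources but `w` and `v`. -/
lemma clusterSum_sext_of_three {J : Sym2 V → ℝ} (hJ : 0 ≤ J) {u v x y z w : V}
    {K : Finset (Sym2 V)} (hv : v ∉ vertexCluster u K) (hx : x ∈ vertexCluster u K)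
    (hy : y ∈ vertexCluster u K) (hz : z ∈ vertexCluster u K) (hw : w ∉ vertexCluster u K) :
    clusterSum J u (sext x y z w u v) K ≤ linkSum₃ J u x y z K * corr J w v := by
  have hu := self_mem_vertexCluster u K
  have h6 : sext x y z w u v =
      fun σ => (spin σ u * spin σ x * (spin σ y * spin σ z)) * (spin σ w * spin σ v) := by
    ext σ; simp only [sext]; ring
  rw [h6, clusterSum_mul J (dependsOn_quad hu hx hy hz) (dependsOn_pair hw hv), linkSum₃,
    if_pos ⟨hx, hy, hz⟩]
  exact mul_le_mul_of_nonneg_left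
    (corr_mono (couplingOff_nonneg hJ _) (couplingOff_le hJ _) w v)
    (clusterSum_nonneg hJ u (quad_mem_ferro u x y z) K)

lemma sext_swap_left (x y z w u v : V) : sext x y z w u v = sext y x z w u v := by
  ext σ; simp only [sext]; ring

lemma sext_swap_right (x y z w u v : V) : sext x y z w u v = sext x y w z u v := by
  ext σ; simp only [sext]; ring

lemma sext_swap (x y z w u v : V) : sext x y z w u v = sext z w x y u v := by
  ext σ; simp only [sext]; ring

/-- Parity drives the bound: a cluster of `u` avoiding `v` must contain an odd number of `x, y, z,
w`, that is one (first four terms) or three (last four). -/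
lemma clusterSum_cumulant_le {J : Sym2 V → ℝ} (hJ : 0 ≤ J) {u v : V} (x y z w : V)
    {K : Finset (Sym2 V)} (hv : v ∉ vertexCluster u K) :
    clusterSum J u (sext x y z w u v) K -
      corr J z w * clusterSum J u (fun σ => spin σ x * spin σ y * (spin σ u * spin σ v)) K -
      corr J x y * clusterSum J u (fun σ => spin σ z * spin σ w * (spin σ u * spin σ v)) K ≤
    linkSum J u x K * (corr J y z * corr J w v + corr J y w * corr J z v) +
    linkSum J u y K * (corr J x z * corr J w v + corr J x w * corr J z v) +
    linkSum J u z K * (corr J w x * corr J y v + corr J w y * corr J x v) +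
    linkSum J u w K * (corr J z x * corr J y v + corr J z y * corr J x v) +
    linkSum₃ J u x y z K * corr J w v + linkSum₃ J u x y w K * corr J z v +
    linkSum₃ J u z w x K * corr J y v + linkSum₃ J u z w y K * corr J x v := by
  have hu := self_mem_vertexCluster u K
  have n := fun a b => corr_nonneg hJ a b
  have ne := mul_nonneg (n z w) (clusterSum_nonneg hJ u (quad_mem_ferro x y u v) K)
  have nf := mul_nonneg (n x y) (clusterSum_nonneg hJ u (quad_mem_ferro z w u v) K)
  have l1 : ∀ a b c d e f g h i, 0 ≤ linkSum J u a K *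
      (corr J b c * corr J d e + corr J f g * corr J h i) := fun a b c d e f g h i =>
    mul_nonneg (linkSum_nonneg hJ u a K)
      (add_nonneg (mul_nonneg (n _ _) (n _ _)) (mul_nonneg (n _ _) (n _ _)))
  have l3 : ∀ a b c d, 0 ≤ linkSum₃ J u a b c K * corr J d v := fun a b c d =>
    mul_nonneg (linkSum₃_nonneg hJ u a b c K) (n _ _)
  have a1 := l1 x y z w v y w z v
  have a2 := l1 y x z w v x w z v
  have a3 := l1 z w x y v w y x v
  have a4 := l1 w z x y v z y x v
  have b1 := l3 x y z w
  have b2 := l3 x y w z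
  have b3 := l3 z w x y
  have b4 := l3 z w y x
  have hyx : (fun σ : V → ℤˣ => spin σ x * spin σ y * (spin σ u * spin σ v)) =
      fun σ => spin σ y * spin σ x * (spin σ u * spin σ v) := by ext σ; ring
  have hwz : (fun σ : V → ℤˣ => spin σ z * spin σ w * (spin σ u * spin σ v)) =
      fun σ => spin σ w * spin σ z * (spin σ u * spin σ v) := by ext σ; ring
  by_cases hx : x ∈ vertexCluster u K <;> by_cases hy : y ∈ vertexCluster u K <;>
    by_cases hz : z ∈ vertexCluster u K <;> by_cases hw : w ∈ vertexCluster u K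
  -- Of the 16 cases, four have one source, four have three, and in the rest the six-spin weight
  -- vanishes by a flip. All unused terms have a favourable sign.
  all_goals
    first
      | have h := clusterSum_sext_of_one hJ hv hx hy hz hw
        linarith
      | have h := clusterSum_sext_of_one hJ hv hy hx hz hw
        rw [← sext_swap_left, ← hyx] at h
        linarith
      | have h := clusterSum_sext_of_one hJ hv hz hw hx hy
        rw [← sext_swap] at h
        linarith
      | have h := clusterSum_sext_of_one hJ hv hw hz hx hy
        rw [← sext_swap, ← sext_swap_right, ← hwz] at h
        linarith
      | have h := clusterSum_sext_of_three hJ hv hx hy hz hw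
        linarith
      | have h := clusterSum_sext_of_three hJ hv hx hy hw hz
        rw [← sext_swap_right] at h
        linarith
      | have h := clusterSum_sext_of_three hJ hv hz hw hx hy
        rw [← sext_swap] at h
        linarith
      | have h := clusterSum_sext_of_three hJ hv hz hw hy hx
        rw [← sext_swap, ← sext_swap_left] at h
        linarith
      | have h0 : clusterSum J u (sext x y z w u v) K = 0 :=
          clusterSum_eq_zero_of_flip fun σ => by
            simp [sext, spin_flip_of_mem, spin_flip_of_notMem, *]
        linarith

/-- Upper bound on the third cumulant of three bonds `xy`, `zw`, `uv` by triangle diagrams. -/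
lemma cumulant_le {J : Sym2 V → ℝ} (hJ : 0 ≤ J) (x y z w u v : V) :
    (av J (sext x y z w u v) - corr4 J x y z w * corr J u v) -
      corr J z w * (corr4 J x y u v - corr J x y * corr J u v) -
      corr J x y * (corr4 J z w u v - corr J z w * corr J u v) ≤
    corr J u x * (2 * (corr J y z * corr J w v) + 2 * (corr J y w * corr J z v)) +
    corr J u y * (corr J x z * corr J w v + corr J x w * corr J z v) +
    corr J u z * (2 * (corr J w x * corr J y v) + 2 * (corr J w y * corr J x v)) +
    corr J u w * (corr J z x * corr J y v + corr J z y * corr J x v) := by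
  classical
  have n := fun a b => corr_nonneg hJ a b
  have conv : ∀ F : (V → ℤˣ) → ℝ,
      pf J ^ 2 * (av J (fun σ => F σ * (spin σ u * spin σ v)) - av J F * corr J u v) =
      ∑ K, if v ∉ vertexCluster u K then
        clusterSum J u (fun σ => F σ * (spin σ u * spin σ v)) K else 0 := by
    intro F
    rw [pf_sq_mul_cov, sum_clusterSum J u _ (fun S => v ∉ S)]
    exact Finset.sum_congr rfl fun ω _ => by rw [ite_not]
  have h6 := conv fun σ => spin σ x * spin σ y * (spin σ z * spin σ w)
  have he := conv fun σ => spin σ x * spin σ y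
  have hf := conv fun σ => spin σ z * spin σ w
  have s1 := fun a => sum_linkSum_le hJ u a
  have s3 := fun a b c => sum_linkSum₃_le hJ u a b c
  have key : pf J ^ 2 * ((av J (sext x y z w u v) - corr4 J x y z w * corr J u v) -
      corr J z w * (corr4 J x y u v - corr J x y * corr J u v) -
      corr J x y * (corr4 J z w u v - corr J z w * corr J u v)) ≤
    (∑ K, linkSum J u x K) * (corr J y z * corr J w v + corr J y w * corr J z v) +
    (∑ K, linkSum J u y K) * (corr J x z * corr J w v + corr J x w * corr J z v) +
    (∑ K, linkSum J u z K) * (corr J w x * corr J y v + corr J w y * corr J x v) +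
    (∑ K, linkSum J u w K) * (corr J z x * corr J y v + corr J z y * corr J x v) +
    (∑ K, linkSum₃ J u x y z K) * corr J w v + (∑ K, linkSum₃ J u x y w K) * corr J z v +
    (∑ K, linkSum₃ J u z w x K) * corr J y v + (∑ K, linkSum₃ J u z w y K) * corr J x v := by
    have e : pf J ^ 2 * ((av J (sext x y z w u v) - corr4 J x y z w * corr J u v) -
      corr J z w * (corr4 J x y u v - corr J x y * corr J u v) -
      corr J x y * (corr4 J z w u v - corr J z w * corr J u v)) =
      pf J ^ 2 * (av J (sext x y z w u v) - corr4 J x y z w * corr J u v) -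
      corr J z w * (pf J ^ 2 * (corr4 J x y u v - corr J x y * corr J u v)) -
      corr J x y * (pf J ^ 2 * (corr4 J z w u v - corr J z w * corr J u v)) := by ring
    rw [e]
    have h6' : pf J ^ 2 * (av J (sext x y z w u v) - corr4 J x y z w * corr J u v) = _ := h6
    have he' : pf J ^ 2 * (corr4 J x y u v - corr J x y * corr J u v) = _ := he
    have hf' : pf J ^ 2 * (corr4 J z w u v - corr J z w * corr J u v) = _ := hf
    rw [h6', he', hf']
    simp only [Finset.sum_mul, Finset.mul_sum, ← Finset.sum_add_distrib,
      ← Finset.sum_sub_distrib]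
    refine Finset.sum_le_sum fun K _ => ?_
    by_cases hv : v ∉ vertexCluster u K
    · simp only [if_pos hv]
      exact clusterSum_cumulant_le hJ x y z w hv
    · simp only [if_neg hv]
      have l1 := fun a => linkSum_nonneg hJ u a K
      have l3 := fun a b c => linkSum₃_nonneg hJ u a b c K
      have : ∀ a b c d e f g h i, 0 ≤ linkSum J u a K *
          (corr J b c * corr J d e + corr J f g * corr J h i) := fun a b c d e f g h i =>
        mul_nonneg (l1 a) (add_nonneg (mul_nonneg (n _ _) (n _ _)) (mul_nonneg (n _ _) (n _ _)))
      have t1 := this x y z w v y w z v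
      have t2 := this y x z w v x w z v
      have t3 := this z w x y v w y x v
      have t4 := this w z x y v z y x v
      have t5 := mul_nonneg (l3 x y z) (n w v)
      have t6 := mul_nonneg (l3 x y w) (n z v)
      have t7 := mul_nonneg (l3 z w x) (n y v)
      have t8 := mul_nonneg (l3 z w y) (n x v)
      simp only [mul_zero]
      linarith
  refine le_of_mul_le_mul_left (key.trans ?_) (pow_pos (pf_pos J) 2)
  have m1 : ∀ a b c d e f g h i, (∑ K, linkSum J u a K) *
      (corr J b c * corr J d e + corr J f g * corr J h i) ≤ pf J ^ 2 * corr J u a *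
      (corr J b c * corr J d e + corr J f g * corr J h i) := fun a b c d e f g h i =>
    mul_le_mul_of_nonneg_right (s1 a)
      (add_nonneg (mul_nonneg (n _ _) (n _ _)) (mul_nonneg (n _ _) (n _ _)))
  have m3 : ∀ a b c d, (∑ K, linkSum₃ J u a b c K) * corr J d v ≤
      pf J ^ 2 * (corr J u a * corr J b c) * corr J d v := fun a b c d =>
    mul_le_mul_of_nonneg_right (s3 a b c) (n _ _)
  -- The three-source bounds `t5` to `t8` repeat products already present in `t1` and `t3`, whence
  -- the coefficients `2` on the terms with `u x` and `u z`.
  have t1 := m1 x y z w v y w z v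
  have t2 := m1 y x z w v x w z v
  have t3 := m1 z w x y v w y x v
  have t4 := m1 w z x y v z y x v
  have t5 := m3 x y z w
  have t6 := m3 x y w z
  have t7 := m3 z w x y
  have t8 := m3 z w y x
  linarith

end ThirdCumulant

/-! ### Energy variance and its change when edges are removed. -/

section Variance

variable {V : Type*} [Fintype V] [DecidableEq V]

lemma sum_pair_eq_zero {x y : V} (h : x ≠ y) : ∑ σ : V → ℤˣ, spin σ x * spin σ y = 0 := by
  have := Equiv.sum_comp (Equiv.mulLeft (flip {x})) fun σ => spin σ x * spin σ y
  have hx : x ∈ ({x} : Set V) := rfl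
  have hy : y ∉ ({x} : Set V) := fun hy => h hy.symm
  simp only [Equiv.coe_mulLeft, spin_mul, spin_flip_of_mem hx, spin_flip_of_notMem hy, neg_mul,
    one_mul, Finset.sum_neg_distrib] at this
  linarith

/-- By Griffiths, all couplings but the one on `xy` may be set to zero; the remaining two-spin model
gives exactly `tanh`. -/
lemma tanh_le_corr {J : Sym2 V → ℝ} (hJ : 0 ≤ J) {x y : V} (h : x ≠ y) :
    Real.tanh (J s(x, y)) ≤ corr J x y := by
  have h0 : (0 : Sym2 V → ℝ) ≤ Pi.single s(x, y) (J s(x, y)) := by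
    rw [Pi.single_nonneg]; exact hJ _
  have hle : Pi.single s(x, y) (J s(x, y)) ≤ J := by
    intro e
    by_cases he : e = s(x, y)
    · subst he; simp
    · simpa [he] using hJ e
  refine le_trans (le_of_eq ?_) (corr_mono h0 hle x y)
  have hb : ∀ σ, boltz (Pi.single s(x, y) (J s(x, y))) σ =
      Real.cosh (J s(x, y)) + Real.sinh (J s(x, y)) * (spin σ x * spin σ y) := by
    intro σ
    rw [boltz, Finset.sum_eq_single s(x, y), Pi.single_eq_same, exp_mul_bond, bond_mk]
    · intro e _ he
      simp [he]
    · simp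
  have hnum : ∑ σ : V → ℤˣ, spin σ x * spin σ y * (Real.cosh (J s(x, y)) +
      Real.sinh (J s(x, y)) * (spin σ x * spin σ y)) =
      Fintype.card (V → ℤˣ) * Real.sinh (J s(x, y)) := by
    have : ∀ σ : V → ℤˣ, spin σ x * spin σ y * (Real.cosh (J s(x, y)) +
      Real.sinh (J s(x, y)) * (spin σ x * spin σ y)) =
      (spin σ x * spin σ y) * Real.cosh (J s(x, y)) + Real.sinh (J s(x, y)) := fun σ => by
        linear_combination Real.sinh (J s(x, y)) * spin σ y ^ 2 * spin_sq σ x +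
          Real.sinh (J s(x, y)) * spin_sq σ y
    simp only [this, Finset.sum_add_distrib, ← Finset.sum_mul, sum_pair_eq_zero h]
    simp
  have hden : ∑ σ : V → ℤˣ, (Real.cosh (J s(x, y)) +
      Real.sinh (J s(x, y)) * (spin σ x * spin σ y)) =
      Fintype.card (V → ℤˣ) * Real.cosh (J s(x, y)) := by
    simp only [Finset.sum_add_distrib, ← Finset.mul_sum, sum_pair_eq_zero h]
    simp
  rw [corr, av, pf]
  simp only [hb]
  rw [hnum, hden, Real.tanh_eq_sinh_div_cosh, mul_div_mul_left]
  positivity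

/-- Covariance of two bonds. -/
def bondCov (J : Sym2 V → ℝ) (e f : Sym2 V) : ℝ :=
  av J (fun σ => bond σ e * bond σ f) - av J (fun σ => bond σ e) * av J (fun σ => bond σ f)

/-- Third cumulant of three bonds. -/
def bondCum (J : Sym2 V → ℝ) (e f g : Sym2 V) : ℝ :=
  (av J (fun σ => bond σ e * bond σ f * bond σ g) -
      av J (fun σ => bond σ e * bond σ f) * av J (fun σ => bond σ g)) -
    av J (fun σ => bond σ f) * bondCov J e g - av J (fun σ => bond σ e) * bondCov J f g

lemma bondCov_comm (J : Sym2 V → ℝ) (e f : Sym2 V) : bondCov J e f = bondCov J f e := by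
  simp only [bondCov, mul_comm]

lemma bondCov_nonneg {J : Sym2 V → ℝ} (hJ : 0 ≤ J) (e f : Sym2 V) : 0 ≤ bondCov J e f :=
  sub_nonneg.2 (av_mul_av_bond_le hJ (bond_mem_ferro e) f)

lemma hasDerivAt_bondCov (J D : Sym2 V → ℝ) (e f : Sym2 V) (t : ℝ) :
    HasDerivAt (fun t : ℝ => bondCov (J + t • D) e f)
      (∑ g, D g * bondCum (J + t • D) e f g) t := by
  refine ((hasDerivAt_av J D (fun σ => bond σ e * bond σ f) t).sub
    ((hasDerivAt_av J D (fun σ => bond σ e) t).mul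
      (hasDerivAt_av J D (fun σ => bond σ f) t))).congr_deriv ?_
  rw [Finset.sum_mul, Finset.mul_sum, ← Finset.sum_add_distrib, ← Finset.sum_sub_distrib]
  refine Finset.sum_congr rfl fun g _ => ?_
  simp only [bondCum, bondCov]
  ring

/-- Two-point functions `τ` on a graph with edge set `E` whose values at neighbouring points are
comparable. -/
structure Comparable (E : Finset (Sym2 V)) (τ : V → V → ℝ) (q : ℝ) : Prop where
  symm : ∀ x y, τ x y = τ y x
  nonneg : ∀ x y, 0 ≤ τ x y
  le : ∀ e ∈ E, ∀ x ∈ e, ∀ y ∈ e, ∀ z, τ x z ≤ q * τ y z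

namespace Comparable

variable {E : Finset (Sym2 V)} {τ : V → V → ℝ} {q : ℝ}

lemma le_sq (h : Comparable E τ q) (hq : 0 ≤ q) {e f : Sym2 V} (he : e ∈ E) (hf : f ∈ E)
    {x x' z z' : V} (hx : x ∈ e) (hx' : x' ∈ e) (hz : z ∈ f) (hz' : z' ∈ f) :
    τ x' z' ≤ q ^ 2 * τ x z := by
  refine (h.le e he x' hx' x hx z').trans ?_
  rw [sq, mul_assoc, h.symm x z', h.symm x z]
  exact mul_le_mul_of_nonneg_left (h.le f hf z' hz' z hz x) hq

/-- Lebowitz leaves two products of two correlations. Moving all endpoints to `x` and `z` costs `q²`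
per correlation. -/
lemma bondCov_le (h : Comparable E τ q) (hq : 0 ≤ q) {J : Sym2 V → ℝ} (hJ : 0 ≤ J)
    (hτ : ∀ x y, corr J x y ≤ τ x y) {e f : Sym2 V} (he : e ∈ E) (hf : f ∈ E) {x z : V}
    (hx : x ∈ e) (hz : z ∈ f) : bondCov J e f ≤ 2 * q ^ 4 * (τ x z * τ x z) := by
  obtain ⟨y, rfl⟩ := hx
  obtain ⟨w, rfl⟩ := hz
  have hL := corr4_le hJ x y z w
  have hb : bondCov J s(x, y) s(z, w) = corr4 J x y z w - corr J x y * corr J z w := by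
    simp [bondCov, corr4, corr]
  have key : ∀ a ∈ s(x, y), ∀ b ∈ s(z, w), corr J a b ≤ q ^ 2 * τ x z := fun a ha b hb =>
    (hτ a b).trans (h.le_sq hq he hf (Sym2.mem_mk_left _ _) ha (Sym2.mem_mk_left _ _) hb)
  have mul : ∀ a ∈ s(x, y), ∀ b ∈ s(z, w), ∀ c ∈ s(x, y), ∀ d ∈ s(z, w),
      corr J a b * corr J c d ≤ q ^ 4 * (τ x z * τ x z) := fun a ha b hb c hc d hd => by
    refine (mul_le_mul (key a ha b hb) (key c hc d hd) (corr_nonneg hJ _ _)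
      (mul_nonneg (sq_nonneg q) (h.nonneg _ _))).trans_eq (by ring)
  have m1 := mul x (by simp) z (by simp) y (by simp) w (by simp)
  have m2 := mul x (by simp) w (by simp) y (by simp) z (by simp)
  linarith

/-- The coefficients in `cumulant_le` add up to `12`, and each of the three correlations costs `q²`
when its endpoints are moved to `u, x, z`. -/
lemma bondCum_le (h : Comparable E τ q) (hq : 0 ≤ q) {J : Sym2 V → ℝ} (hJ : 0 ≤ J)
    (hτ : ∀ x y, corr J x y ≤ τ x y) {e f g : Sym2 V} (he : e ∈ E) (hf : f ∈ E) (hg : g ∈ E)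
    {x z u : V} (hx : x ∈ e) (hz : z ∈ f) (hu : u ∈ g) :
    bondCum J e f g ≤ 12 * q ^ 6 * (τ u x * τ x z * τ z u) := by
  obtain ⟨y, rfl⟩ := hx
  obtain ⟨w, rfl⟩ := hz
  obtain ⟨v, rfl⟩ := hu
  have hb : bondCum J s(x, y) s(z, w) s(u, v) =
      (av J (sext x y z w u v) - corr4 J x y z w * corr J u v) -
      corr J z w * (corr4 J x y u v - corr J x y * corr J u v) -
      corr J x y * (corr4 J z w u v - corr J z w * corr J u v) := by
    simp only [bondCum, bondCov, corr4, corr, bond_mk]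
    rfl
  have hL := cumulant_le hJ x y z w u v
  have k1 : ∀ a ∈ s(u, v), ∀ b ∈ s(x, y), corr J a b ≤ q ^ 2 * τ u x := fun a ha b hb =>
    (hτ a b).trans (h.le_sq hq hg he (Sym2.mem_mk_left _ _) ha (Sym2.mem_mk_left _ _) hb)
  have k2 : ∀ a ∈ s(x, y), ∀ b ∈ s(z, w), corr J a b ≤ q ^ 2 * τ x z := fun a ha b hb =>
    (hτ a b).trans (h.le_sq hq he hf (Sym2.mem_mk_left _ _) ha (Sym2.mem_mk_left _ _) hb)
  have k3 : ∀ a ∈ s(z, w), ∀ b ∈ s(u, v), corr J a b ≤ q ^ 2 * τ z u := fun a ha b hb =>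
    (hτ a b).trans (h.le_sq hq hf hg (Sym2.mem_mk_left _ _) ha (Sym2.mem_mk_left _ _) hb)
  have n := fun a b => corr_nonneg hJ a b
  have mul : ∀ a ∈ s(u, v), ∀ b ∈ s(x, y), ∀ b' ∈ s(x, y), ∀ c ∈ s(z, w), ∀ c' ∈ s(z, w),
      ∀ a' ∈ s(u, v), corr J a b * (corr J b' c * corr J c' a') ≤
        q ^ 6 * (τ u x * τ x z * τ z u) := by
    intro a ha b hb b' hb' c hc c' hc' a' ha'
    have p : ∀ a b, 0 ≤ q ^ 2 * τ a b := fun a b => mul_nonneg (sq_nonneg q) (h.nonneg _ _)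
    exact (mul_le_mul (k1 a ha b hb) (mul_le_mul (k2 b' hb' c hc) (k3 c' hc' a' ha') (n _ _)
      (p _ _)) (mul_nonneg (n _ _) (n _ _)) (p _ _)).trans_eq (by ring)
  have m1 := mul u (by simp) x (by simp) y (by simp) z (by simp) w (by simp) v (by simp)
  have m2 := mul u (by simp) x (by simp) y (by simp) w (by simp) z (by simp) v (by simp)
  have m3 := mul u (by simp) y (by simp) x (by simp) z (by simp) w (by simp) v (by simp)
  have m4 := mul u (by simp) y (by simp) x (by simp) w (by simp) z (by simp) v (by simp)
  have mul' : ∀ a ∈ s(u, v), ∀ c ∈ s(z, w), ∀ c' ∈ s(z, w), ∀ b ∈ s(x, y), ∀ b' ∈ s(x, y),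
      ∀ a' ∈ s(u, v), corr J a c * (corr J c' b * corr J b' a') ≤
        q ^ 6 * (τ u x * τ x z * τ z u) := by
    intro a ha c hc c' hc' b hb b' hb' a' ha'
    refine le_trans (le_of_eq ?_) (mul a' ha' b' hb' b hb c' hc' c hc a ha)
    rw [corr_comm J a c, corr_comm J c' b, corr_comm J b' a']
    ring
  have m5 := mul' u (by simp) z (by simp) w (by simp) x (by simp) y (by simp) v (by simp)
  have m6 := mul' u (by simp) z (by simp) w (by simp) y (by simp) x (by simp) v (by simp)
  have m7 := mul' u (by simp) w (by simp) z (by simp) x (by simp) y (by simp) v (by simp)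
  have m8 := mul' u (by simp) w (by simp) z (by simp) y (by simp) x (by simp) v (by simp)
  linarith

end Comparable

lemma sum_edges_le {E : Finset (Sym2 V)} {Δ : ℝ}
    (hΔ : ∀ x, (({e ∈ E | x ∈ e} : Finset (Sym2 V)).card : ℝ) ≤ Δ) {φ : Sym2 V → ℝ} {ψ : V → ℝ}
    (hψ : ∀ x, 0 ≤ ψ x) (h : ∀ e ∈ E, ∀ x ∈ e, φ e ≤ ψ x) :
    ∑ e ∈ E, φ e ≤ Δ * ∑ x, ψ x := by
  calc ∑ e ∈ E, φ e ≤ ∑ e ∈ E, ∑ x, if x ∈ e then ψ x else 0 := by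
        refine Finset.sum_le_sum fun e he => (h e he _ (Sym2.out_fst_mem e)).trans ?_
        refine le_trans (le_of_eq ?_) (Finset.single_le_sum
          (f := fun x => if x ∈ e then ψ x else 0) (fun x _ => ?_)
          (Finset.mem_univ (Quot.out e).1))
        · simp [Sym2.out_fst_mem e]
        · split_ifs
          · exact hψ x
          · exact le_rfl
    _ = ∑ x, (({e ∈ E | x ∈ e} : Finset (Sym2 V)).card : ℝ) * ψ x := by
        rw [Finset.sum_comm]
        refine Finset.sum_congr rfl fun x _ => ?_
        rw [← Finset.sum_filter, Finset.sum_const, nsmul_eq_mul]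
    _ ≤ ∑ x, Δ * ψ x := Finset.sum_le_sum fun x _ => mul_le_mul_of_nonneg_right (hΔ x) (hψ x)
    _ = Δ * ∑ x, ψ x := by rw [Finset.mul_sum]

lemma card_touching_le {E R : Finset (Sym2 V)} {Δ : ℝ}
    (hΔ : ∀ x, (({e ∈ E | x ∈ e} : Finset (Sym2 V)).card : ℝ) ≤ Δ) {S : Set V} (hR : R ⊆ E)
    (hRS : ∀ e ∈ R, ∃ x ∈ e, x ∈ S) : (R.card : ℝ) ≤ Δ * S.ncard := by
  classical
  have hsub : R ⊆ S.toFinset.biUnion fun x => {e ∈ E | x ∈ e} := by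
    intro e he
    obtain ⟨x, hx, hxS⟩ := hRS e he
    exact Finset.mem_biUnion.2 ⟨x, by simpa using hxS, Finset.mem_filter.2 ⟨hR he, hx⟩⟩
  have h1 : (R.card : ℝ) ≤ ∑ x ∈ S.toFinset, (({e ∈ E | x ∈ e} : Finset (Sym2 V)).card : ℝ) := by
    exact_mod_cast (Finset.card_le_card hsub).trans Finset.card_biUnion_le
  refine h1.trans ((Finset.sum_le_sum fun x _ => hΔ x).trans_eq ?_)
  rw [Finset.sum_const, nsmul_eq_mul, Set.ncard_eq_toFinset_card', mul_comm]

/-- Constant couplings `s` on the edges of `E`. -/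
def edgeCoupling (E : Finset (Sym2 V)) (s : ℝ) (e : Sym2 V) : ℝ := if e ∈ E then s else 0

lemma edgeCoupling_nonneg (E : Finset (Sym2 V)) {s : ℝ} (hs : 0 ≤ s) : 0 ≤ edgeCoupling E s := by
  intro e
  simp only [edgeCoupling, Pi.zero_apply]
  split_ifs
  · exact hs
  · exact le_rfl

lemma edgeCoupling_mono {E E' : Finset (Sym2 V)} (hE : E ⊆ E') {s s' : ℝ} (hs : 0 ≤ s)
    (hss' : s ≤ s') : edgeCoupling E s ≤ edgeCoupling E' s' := by
  intro e
  simp only [edgeCoupling]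
  by_cases he : e ∈ E
  · simpa [he, hE he] using hss'
  · simp only [he, if_false]
    split_ifs
    · exact hs.trans hss'
    · exact le_rfl

/-- Variance of the energy `∑_{e ∈ E} σ_e` under the Ising model on `E` with couplings `s`. -/
def energyVar (E : Finset (Sym2 V)) (s : ℝ) : ℝ :=
  ∑ e ∈ E, ∑ f ∈ E, bondCov (edgeCoupling E s) e f

/-- Removing the edges that touch `S` changes the energy variance by at most a multiple of
`|S|`, controlled by the triangle diagram. -/
lemma energyVar_sub_le {E E' : Finset (Sym2 V)} {q Δ T s b : ℝ} {S : Set V}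
    (hs : 0 ≤ s) (hsb : s ≤ b) (hq : 0 ≤ q) (hE' : E' ⊆ E)
    (hS : ∀ e ∈ E \ E', ∃ x ∈ e, x ∈ S)
    (hΔ : ∀ x, (({e ∈ E | x ∈ e} : Finset (Sym2 V)).card : ℝ) ≤ Δ)
    (hcomp : Comparable E (corr (edgeCoupling E b)) q)
    (hT : ∀ u, ∑ x, ∑ z, corr (edgeCoupling E b) u x * corr (edgeCoupling E b) x z *
      corr (edgeCoupling E b) z u ≤ T) :
    energyVar E s - energyVar E' s ≤
      (4 * q ^ 4 * Δ ^ 2 + 12 * q ^ 6 * b * Δ ^ 3) * T * S.ncard := by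
  classical
  set τ := corr (edgeCoupling E b) with hτdef
  set R := E \ E' with hRdef
  have hRE : R ⊆ E := Finset.sdiff_subset
  have hb : 0 ≤ b := hs.trans hsb
  have hcard : (R.card : ℝ) ≤ Δ * S.ncard := card_touching_le hΔ hRE hS
  -- The signs of `Δ` and `T` are read off at some vertex, so the empty vertex set is treated apart.
  rcases isEmpty_or_nonempty V with hV | hV
  · have : E = ∅ := Finset.eq_empty_of_forall_notMem fun e _ => hV.elim e.out.1
    have h' : E' = ∅ := Finset.subset_empty.1 (this ▸ hE')
    have hS0 : S = ∅ := Set.eq_empty_of_isEmpty S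
    simp [this, h', energyVar, hS0]
  have hΔ0 : 0 ≤ Δ := (Nat.cast_nonneg _).trans (hΔ (Classical.arbitrary V))
  have hτ0 := hcomp.nonneg
  have hT0 : 0 ≤ T := (Finset.sum_nonneg fun x _ => Finset.sum_nonneg fun z _ =>
    mul_nonneg (mul_nonneg (hτ0 _ _) (hτ0 _ _)) (hτ0 _ _)).trans (hT (Classical.arbitrary V))
  -- The bubble is the part of the triangle sum where the second vertex coincides with the base
  -- point, since `τ x x = 1`.
  have hbubble : ∀ x, ∑ z, τ x z * τ x z ≤ T := by
    intro x
    refine le_trans ?_ (hT x)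
    refine le_trans (le_of_eq ?_) (Finset.single_le_sum
      (f := fun y => ∑ z, τ x y * τ y z * τ z x) (fun y _ => Finset.sum_nonneg fun z _ =>
        mul_nonneg (mul_nonneg (hτ0 _ _) (hτ0 _ _)) (hτ0 _ _)) (Finset.mem_univ x))
    refine Finset.sum_congr rfl fun z _ => ?_
    rw [hcomp.symm z x, hτdef, corr_self, one_mul]
  have hcov : ∀ J : Sym2 V → ℝ, 0 ≤ J → (∀ x y, corr J x y ≤ τ x y) → ∀ e ∈ E,
      ∑ f ∈ E, bondCov J e f ≤ 2 * q ^ 4 * Δ * T := by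
    intro J hJ hle e he
    have hx := Sym2.out_fst_mem e
    refine (sum_edges_le (ψ := fun z => 2 * q ^ 4 * (τ e.out.1 z * τ e.out.1 z)) hΔ
      (fun z => by have := mul_nonneg (hτ0 e.out.1 z) (hτ0 e.out.1 z); positivity)
      fun f hf z hz => hcomp.bondCov_le hq hJ hle he hf hx hz).trans ?_
    rw [← Finset.mul_sum]
    calc Δ * (2 * q ^ 4 * ∑ z, τ e.out.1 z * τ e.out.1 z) ≤ Δ * (2 * q ^ 4 * T) := by
          have := hbubble e.out.1
          gcongr
      _ = _ := by ring
  have hcum : ∀ J : Sym2 V → ℝ, 0 ≤ J → (∀ x y, corr J x y ≤ τ x y) → ∀ g ∈ E,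
      ∑ e ∈ E', ∑ f ∈ E', bondCum J e f g ≤ 12 * q ^ 6 * Δ ^ 2 * T := by
    intro J hJ hle g hg
    have hu := Sym2.out_fst_mem g
    set u := g.out.1
    have hΔ' : ∀ x, (({e ∈ E' | x ∈ e} : Finset (Sym2 V)).card : ℝ) ≤ Δ := fun x =>
      (Nat.cast_le.2 (Finset.card_le_card (Finset.filter_subset_filter _ hE'))).trans (hΔ x)
    have hnn : ∀ x z, 0 ≤ 12 * q ^ 6 * (τ u x * τ x z * τ z u) := fun x z => by
      have := mul_nonneg (mul_nonneg (hτ0 u x) (hτ0 x z)) (hτ0 z u)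
      positivity
    have h1 : ∀ e ∈ E', ∀ x ∈ e, ∑ f ∈ E', bondCum J e f g ≤
        Δ * ∑ z, 12 * q ^ 6 * (τ u x * τ x z * τ z u) := fun e he x hx =>
      sum_edges_le hΔ' (hnn x) fun f hf z hz =>
        hcomp.bondCum_le hq hJ hle (hE' he) (hE' hf) hg hx hz hu
    refine (sum_edges_le hΔ' (fun x => mul_nonneg hΔ0 (Finset.sum_nonneg fun z _ => hnn x z))
      h1).trans ?_
    simp only [← Finset.mul_sum]
    calc Δ * (Δ * (12 * q ^ 6 * ∑ x, ∑ z, τ u x * τ x z * τ z u)) ≤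
          Δ * (Δ * (12 * q ^ 6 * T)) := by
          have := hT u
          gcongr
      _ = _ := by ring
  set J₁ := edgeCoupling E s with hJ₁
  have hJ₁0 : 0 ≤ J₁ := edgeCoupling_nonneg E hs
  have hJ₁le : ∀ x y, corr J₁ x y ≤ τ x y :=
    corr_mono hJ₁0 (edgeCoupling_mono le_rfl hs hsb)
  -- Pairs meeting `R` are counted at most twice, once for each position of the removed edge.
  have hsplit : energyVar E s ≤ ∑ e ∈ E', ∑ f ∈ E', bondCov J₁ e f +
      2 * (R.card * (2 * q ^ 4 * Δ * T)) := by
    have hR : ∑ e ∈ R, ∑ f ∈ E, bondCov J₁ e f ≤ R.card * (2 * q ^ 4 * Δ * T) := by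
      rw [← nsmul_eq_mul]
      exact Finset.sum_le_card_nsmul _ _ _ fun e he => hcov J₁ hJ₁0 hJ₁le e (hRE he)
    have hR' : ∑ e ∈ E', ∑ f ∈ R, bondCov J₁ e f ≤ R.card * (2 * q ^ 4 * Δ * T) := by
      refine le_trans ?_ hR
      rw [Finset.sum_comm]
      refine Finset.sum_le_sum fun f _ => ?_
      simp only [bondCov_comm J₁ _ f]
      exact Finset.sum_le_sum_of_subset_of_nonneg hE' fun e _ _ => bondCov_nonneg hJ₁0 _ _
    have e1 : energyVar E s = ∑ e ∈ R, ∑ f ∈ E, bondCov J₁ e f +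
        ∑ e ∈ E', ∑ f ∈ E, bondCov J₁ e f := (Finset.sum_sdiff hE').symm
    have e2 : ∑ e ∈ E', ∑ f ∈ E, bondCov J₁ e f = ∑ e ∈ E', ∑ f ∈ R, bondCov J₁ e f +
        ∑ e ∈ E', ∑ f ∈ E', bondCov J₁ e f := by
      rw [← Finset.sum_add_distrib]
      exact Finset.sum_congr rfl fun e _ => (Finset.sum_sdiff hE').symm
    rw [e1, e2]
    linarith
  set J₀ := edgeCoupling E' s with hJ₀
  set D := edgeCoupling R s with hD
  have hJ₁eq : J₁ = J₀ + (1 : ℝ) • D := by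
    ext e
    simp only [hJ₁, hJ₀, hD, edgeCoupling, Pi.add_apply, Pi.smul_apply, hRdef, Finset.mem_sdiff]
    by_cases h1 : e ∈ E <;> by_cases h2 : e ∈ E'
    · simp [h1, h2]
    · simp [h1, h2]
    · exact absurd (hE' h2) h1
    · simp [h1, h2]
  have hJ₀0 : 0 ≤ J₀ := edgeCoupling_nonneg E' hs
  have hD0 : 0 ≤ D := edgeCoupling_nonneg R hs
  have hder : ∀ t : ℝ, HasDerivAt (fun t : ℝ => ∑ e ∈ E', ∑ f ∈ E', bondCov (J₀ + t • D) e f)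
      (∑ e ∈ E', ∑ f ∈ E', ∑ g, D g * bondCum (J₀ + t • D) e f g) t := fun t =>
    HasDerivAt.fun_sum fun e _ => HasDerivAt.fun_sum fun f _ => hasDerivAt_bondCov J₀ D e f t
  -- The couplings on `R` are switched on linearly. Every intermediate coupling lies below `J₁`, so
  -- by Griffiths `τ` bounds its correlations uniformly in `t`.
  have hmv := Convex.image_sub_le_mul_sub_of_deriv_le (convex_Icc (0 : ℝ) 1)
    (f := fun t : ℝ => ∑ e ∈ E', ∑ f ∈ E', bondCov (J₀ + t • D) e f)
    (fun t _ => (hder t).continuousAt.continuousWithinAt)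
    (fun t _ => (hder t).differentiableAt.differentiableWithinAt)
    (C := b * (R.card * (12 * q ^ 6 * Δ ^ 2 * T))) (fun t ht => by
      rw [interior_Icc] at ht
      rw [(hder t).deriv]
      have hJt0 : 0 ≤ J₀ + t • D := add_nonneg hJ₀0 (smul_nonneg ht.1.le hD0)
      have hJt1 : J₀ + t • D ≤ J₁ := by
        rw [hJ₁eq]
        gcongr
        · exact ht.2.le
      have hle : ∀ x y, corr (J₀ + t • D) x y ≤ τ x y := fun x y =>
        (corr_mono hJt0 hJt1 x y).trans (hJ₁le x y)
      have hre : ∑ e ∈ E', ∑ f ∈ E', ∑ g, D g * bondCum (J₀ + t • D) e f g =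
          s * ∑ g ∈ R, ∑ e ∈ E', ∑ f ∈ E', bondCum (J₀ + t • D) e f g := by
        have : ∀ e f, ∑ g, D g * bondCum (J₀ + t • D) e f g =
            s * ∑ g ∈ R, bondCum (J₀ + t • D) e f g := by
          intro e f
          rw [Finset.mul_sum, ← Finset.sum_subset (Finset.subset_univ R)]
          · exact Finset.sum_congr rfl fun g hg => by simp [hD, edgeCoupling, hg]
          · intro g _ hg
            simp [hD, edgeCoupling, hg]
        simp only [this, ← Finset.mul_sum]
        congr 1
        rw [Finset.sum_congr rfl fun e _ => Finset.sum_comm, Finset.sum_comm]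
      rw [hre]
      have h1 : ∑ g ∈ R, ∑ e ∈ E', ∑ f ∈ E', bondCum (J₀ + t • D) e f g ≤
          R.card * (12 * q ^ 6 * Δ ^ 2 * T) := by
        rw [← nsmul_eq_mul]
        exact Finset.sum_le_card_nsmul _ _ _ fun g hg => hcum _ hJt0 hle g (hRE hg)
      have h2 : 0 ≤ (R.card : ℝ) * (12 * q ^ 6 * Δ ^ 2 * T) := by positivity
      exact (mul_le_mul_of_nonneg_left h1 hs).trans (mul_le_mul_of_nonneg_right hsb h2))
    0 (by simp) 1 (by simp) zero_le_one
  simp only [zero_smul, add_zero, sub_zero, mul_one, ← hJ₁eq] at hmv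
  have hfin : energyVar E s - energyVar E' s ≤
      R.card * ((4 * q ^ 4 * Δ + 12 * q ^ 6 * b * Δ ^ 2) * T) := by
    have : energyVar E' s = ∑ e ∈ E', ∑ f ∈ E', bondCov J₀ e f := rfl
    rw [this]
    linarith
  refine hfin.trans ((mul_le_mul_of_nonneg_right hcard (by positivity)).trans_eq (by ring))

end Variance

/-! ### Pinsker-type inequality and Taylor bound. -/

section Entropy

lemma sq_sub_le_max_mul_entropy {p q : ℝ} (hp : 0 < p) (hq : 0 < q) :
    (p - q) ^ 2 ≤ 2 * max p q * (q * Real.log (q / p) - q + p) := by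
  rcases le_total p q with h | h
  · rw [max_eq_right h]
    set t := 1 - p / q with ht
    have hpq : p = q * (1 - t) := by rw [ht]; field_simp; ring
    have ht0 : 0 ≤ t := sub_nonneg.2 ((div_le_one hq).2 h)
    have ht1 : t < 1 := by have := div_pos hp hq; linarith
    have hsum := Real.hasSum_pow_div_log_of_abs_lt_one (abs_lt.2 ⟨by linarith, ht1⟩)
    -- The first two terms of the series give `-log (1 - t) ≥ t + t²/2`.
    have h2 := sum_le_hasSum (Finset.range 2) (fun n _ => by positivity) hsum
    norm_num [Finset.sum_range_succ] at h2
    have hlog : Real.log (q / p) = - Real.log (1 - t) := by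
      rw [← Real.log_inv, ht, sub_sub_cancel, inv_div]
    rw [hlog]
    have h3 : q * (t + t ^ 2 / 2) ≤ q * -Real.log (1 - t) :=
      mul_le_mul_of_nonneg_left (by linarith) hq.le
    have h4 : q * t ^ 2 / 2 ≤ q * -Real.log (1 - t) - q + p := by rw [hpq]; linarith
    calc (p - q) ^ 2 = 2 * q * (q * t ^ 2 / 2) := by rw [hpq]; ring
      _ ≤ _ := mul_le_mul_of_nonneg_left h4 (by positivity)
  · rw [max_eq_left h]
    have hr : 0 < p / q := div_pos hp hq
    -- With `r = p / q ≥ 1`, this is `log r ≤ sinh (log r)`.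
    have h1 : Real.log (p / q) ≤ (p / q - (p / q)⁻¹) / 2 := by
      rw [← Real.sinh_log hr]
      exact Real.self_le_sinh_iff.2 (Real.log_nonneg ((one_le_div hq).2 h))
    have hlog : Real.log (q / p) = - Real.log (p / q) := by
      rw [← Real.log_inv, inv_div]
    rw [hlog]
    have h2 : q * Real.log (p / q) ≤ q * ((p / q - (p / q)⁻¹) / 2) :=
      mul_le_mul_of_nonneg_left h1 hq.le
    have h3 : 2 * p * (q * ((p / q - (p / q)⁻¹) / 2)) = p ^ 2 - q ^ 2 := by field_simp
    have h4 := mul_le_mul_of_nonneg_left h2 (by positivity : 0 ≤ 2 * p)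
    nlinarith

/-- A form of Pinsker's inequality adapted to rare events. -/
lemma sq_sub_le_entropy {ι : Type*} (T B : Finset ι) (hB : B ⊆ T) {p q : ι → ℝ}
    (hp : ∀ i ∈ T, 0 < p i) (hq : ∀ i ∈ T, 0 < q i) (hpq : ∑ i ∈ T, p i = ∑ i ∈ T, q i) :
    (∑ i ∈ B, p i - ∑ i ∈ B, q i) ^ 2 ≤ 4 * max (∑ i ∈ B, p i) (∑ i ∈ B, q i) *
      ∑ i ∈ T, q i * Real.log (q i / p i) := by
  have hk : ∀ i ∈ T, 0 ≤ q i * Real.log (q i / p i) - q i + p i := by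
    intro i hi
    have h1 : 0 < 2 * max (p i) (q i) := by
      have := (hp i hi).trans_le (le_max_left (p i) (q i))
      linarith
    exact nonneg_of_mul_nonneg_right
      ((sq_nonneg _).trans (sq_sub_le_max_mul_entropy (hp i hi) (hq i hi))) h1
  have hmax : ∀ i ∈ B, 0 ≤ 2 * max (p i) (q i) := fun i hi => by
    have := (hp i (hB hi)).le.trans (le_max_left (p i) (q i)); linarith
  -- Cauchy–Schwarz is applied only on `B`, which produces the small factor for rare events. The
  -- correction `- q + p` makes each entropy term nonnegative, so the sum may be enlarged to `T`,
  -- where the corrections cancel.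
  have hcs : (∑ i ∈ B, (p i - q i)) ^ 2 ≤ (∑ i ∈ B, 2 * max (p i) (q i)) *
      ∑ i ∈ B, (q i * Real.log (q i / p i) - q i + p i) :=
    Finset.sum_sq_le_sum_mul_sum_of_sq_le_mul B hmax (fun i hi => hk i (hB hi))
      fun i hi => sq_sub_le_max_mul_entropy (hp i (hB hi)) (hq i (hB hi))
  have h1 : ∑ i ∈ B, 2 * max (p i) (q i) ≤ 4 * max (∑ i ∈ B, p i) (∑ i ∈ B, q i) := by
    have : ∑ i ∈ B, 2 * max (p i) (q i) ≤ ∑ i ∈ B, 2 * (p i + q i) :=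
      Finset.sum_le_sum fun i hi => by
        have := max_le_add_of_nonneg (hp i (hB hi)).le (hq i (hB hi)).le
        linarith
    rw [← Finset.mul_sum (f := fun i => p i + q i), Finset.sum_add_distrib] at this
    have := le_max_left (∑ i ∈ B, p i) (∑ i ∈ B, q i)
    have := le_max_right (∑ i ∈ B, p i) (∑ i ∈ B, q i)
    linarith
  have h2 : ∑ i ∈ B, (q i * Real.log (q i / p i) - q i + p i) ≤
      ∑ i ∈ T, q i * Real.log (q i / p i) := by
    refine (Finset.sum_le_sum_of_subset_of_nonneg hB fun i hi _ => hk i hi).trans_eq ?_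
    rw [Finset.sum_add_distrib, Finset.sum_sub_distrib, hpq]
    ring
  rw [← Finset.sum_sub_distrib]
  have h0 : 0 ≤ ∑ i ∈ B, 2 * max (p i) (q i) := Finset.sum_nonneg hmax
  have h0' : 0 ≤ ∑ i ∈ B, (q i * Real.log (q i / p i) - q i + p i) :=
    Finset.sum_nonneg fun i hi => hk i (hB hi)
  exact hcs.trans (mul_le_mul h1 h2 h0' (h0.trans h1))

/-- Second-order Taylor lower bound. -/
lemma taylor_lower_bound {g g' g'' : ℝ → ℝ} {a b M : ℝ} (hab : a ≤ b)
    (hg : ∀ s ∈ Set.Icc a b, HasDerivAt g (g' s) s)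
    (hg' : ∀ s ∈ Set.Icc a b, HasDerivAt g' (g'' s) s) (hM : ∀ s ∈ Set.Icc a b, -M ≤ g'' s) :
    g a + (b - a) * g' a - M / 2 * (b - a) ^ 2 ≤ g b := by
  have h1 : ∀ s ∈ Set.Icc a b, g' a - M * (s - a) ≤ g' s := by
    intro s hs
    have := (convex_Icc a b).mul_sub_le_image_sub_of_le_deriv (f := g') (C := -M)
      (fun t ht => (hg' t ht).continuousAt.continuousWithinAt)
      (fun t ht => (hg' t (interior_subset ht)).differentiableAt.differentiableWithinAt)
      (fun t ht => by rw [(hg' t (interior_subset ht)).deriv]; exact hM t (interior_subset ht))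
      a (Set.left_mem_Icc.2 hab) s hs hs.1
    linarith
  have hd : ∀ s ∈ Set.Icc a b, HasDerivAt
      (fun s => g s - (g a + (s - a) * g' a - M / 2 * (s - a) ^ 2))
      (g' s - (g' a - M * (s - a))) s := by
    intro s hs
    have e1 : HasDerivAt (fun s : ℝ => s - a) 1 s := (hasDerivAt_id s).sub_const a
    refine ((hg s hs).sub (((e1.mul_const (g' a)).const_add (g a)).sub
      ((e1.pow 2).const_mul (M / 2)))).congr_deriv ?_
    simp
    ring
  have := (monotoneOn_of_deriv_nonneg (convex_Icc a b)
      (fun t ht => (hd t ht).continuousAt.continuousWithinAt)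
      (fun t ht => (hd t (interior_subset ht)).differentiableAt.differentiableWithinAt)
      (fun t ht => by
        rw [(hd t (interior_subset ht)).deriv]
        exact sub_nonneg.2 (h1 t (interior_subset ht))))
      (Set.left_mem_Icc.2 hab) (Set.right_mem_Icc.2 hab) hab
  simp at this
  linarith

end Entropy

/-! ### Edwards–Sokal coupling and the law of the cluster. -/

section EdwardsSokal

variable {V : Type*} [Fintype V] [DecidableEq V]

lemma spin_eq_iff {σ : V → ℤˣ} {x y : V} : spin σ x * spin σ y = 1 ↔ σ x = σ y := by
  rcases Int.units_eq_one_or (σ x) with h | h <;> rcases Int.units_eq_one_or (σ y) with h' | h' <;>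
    norm_num [spin, h, h']

/-- The number of spin configurations constant on the clusters of `ω`. -/
lemma card_constant_on_clusters (ω : Finset (Sym2 V)) :
    Nat.card {σ : V → ℤˣ // ∀ e ∈ ω, bond σ e = 1} =
      2 ^ Nat.card (openGraph ω).ConnectedComponent := by
  classical
  have hreach : ∀ σ : V → ℤˣ, (∀ e ∈ ω, bond σ e = 1) → ∀ u v,
      (openGraph ω).Reachable u v → σ u = σ v := by
    intro σ hσ u v huv
    have := spin_pair_eq_of_reachable (σ := σ) (σ' := 1)
      (fun e he => by rw [hσ e he]; induction e with | _ a b => simp [spin]) huv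
    exact spin_eq_iff.1 (by rw [this]; simp [spin])
  let φ : ((openGraph ω).ConnectedComponent → ℤˣ) → {σ : V → ℤˣ // ∀ e ∈ ω, bond σ e = 1} :=
    fun c => ⟨fun x => c ((openGraph ω).connectedComponentMk x), fun e he => by
      induction e with | _ x y =>
      rw [bond_mk, spin_eq_iff]
      congr 1
      exact SimpleGraph.ConnectedComponent.sound
        (mem_vertexCluster_of_mem_edge he (self_mem_vertexCluster x ω))⟩
  have hφ : Function.Bijective φ := by
    constructor
    · intro c c' h
      ext C
      induction C using SimpleGraph.ConnectedComponent.ind with | _ x =>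
      exact congrArg Units.val (congrFun (congrArg Subtype.val h) x)
    · rintro ⟨σ, hσ⟩
      refine ⟨SimpleGraph.ConnectedComponent.lift σ fun u v p _ => hreach σ hσ u v ⟨p⟩, ?_⟩
      ext x
      simp [φ]
  rw [← Nat.card_eq_of_bijective φ hφ, Nat.card_fun]
  simp

/-- Weight of an open edge in the Edwards–Sokal coupling. -/
def fkFactor (J : Sym2 V → ℝ) (σ : V → ℤˣ) (e : Sym2 V) : ℝ :=
  Real.exp (J e * (1 + bond σ e)) - 1

/-- An open edge forces its end spins to agree and then contributes `e^{2s} - 1`; the compatible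
spin configurations number `2^{k(ω)}`. -/
lemma sum_prod_fkFactor (s : ℝ) {E ω : Finset (Sym2 V)} (hω : ω ⊆ E) :
    ∑ σ, ∏ e ∈ ω, fkFactor (edgeCoupling E s) σ e = fkWeight s ω := by
  classical
  have h : ∀ σ : V → ℤˣ, ∏ e ∈ ω, fkFactor (edgeCoupling E s) σ e =
      if ∀ e ∈ ω, bond σ e = 1 then (Real.exp (2 * s) - 1) ^ ω.card else 0 := by
    intro σ
    split_ifs with hσ
    · rw [← Finset.prod_const]
      refine Finset.prod_congr rfl fun e he => ?_
      rw [fkFactor, hσ e he, edgeCoupling, if_pos (hω he)]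
      ring_nf
    · push Not at hσ
      obtain ⟨e, he, hne⟩ := hσ
      refine Finset.prod_eq_zero he ?_
      rw [fkFactor, (bond_eq_or σ e).resolve_left hne]
      simp
  simp only [h]
  rw [← Finset.sum_filter, Finset.sum_const, nsmul_eq_mul, fkWeight,
    ← Fintype.card_subtype, ← Nat.card_eq_fintype_card, card_constant_on_clusters]
  simp

lemma prod_fkFactor_eq_zero (s : ℝ) {E ω : Finset (Sym2 V)} (hω : ¬ ω ⊆ E) (σ : V → ℤˣ) :
    ∏ e ∈ ω, fkFactor (edgeCoupling E s) σ e = 0 := by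
  obtain ⟨e, he, hne⟩ := Finset.not_subset.1 hω
  exact Finset.prod_eq_zero he (by simp [fkFactor, edgeCoupling, hne])

lemma prod_one_add_fkFactor (s : ℝ) (E T : Finset (Sym2 V)) (σ : V → ℤˣ) :
    ∏ e ∈ T, (1 + fkFactor (edgeCoupling E s) σ e) =
      Real.exp (s * ((E ∩ T).card : ℝ)) * boltz (edgeCoupling (E ∩ T) s) σ := by
  have h : ∏ e ∈ T, (1 + fkFactor (edgeCoupling E s) σ e) =
      Real.exp (∑ e, edgeCoupling (E ∩ T) s e * (1 + bond σ e)) := by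
    rw [Real.exp_sum, ← Finset.prod_subset (Finset.subset_univ T)]
    · exact Finset.prod_congr rfl fun e he => by simp [fkFactor, edgeCoupling, he]
    · intro e _ he
      simp [edgeCoupling, he]
  rw [h, boltz, ← Real.exp_add]
  congr 1
  simp only [mul_add, mul_one, Finset.sum_add_distrib]
  congr 1
  simp only [edgeCoupling, Finset.sum_ite_mem, Finset.univ_inter, Finset.sum_const, nsmul_eq_mul,
    mul_comm]

open Classical in
/-- Total FK weight of the configurations in `E` whose edge cluster at `o` is `K`. -/
def clusterMass (E : Finset (Sym2 V)) (o : V) (s : ℝ) (K : Finset (Sym2 V)) : ℝ :=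
  ∑ ω ∈ E.powerset with edgeCluster o ω = K, fkWeight s ω

/-- The spin sum factorises between the cluster and its complement. Both factors sum over all
vertices, which the cardinality on the left compensates. -/
lemma card_mul_clusterMass {E K : Finset (Sym2 V)} {o : V} (hK : edgeCluster o K = K)
    (hKE : K ⊆ E) (s : ℝ) :
    (Fintype.card (V → ℤˣ) : ℝ) * clusterMass E o s K = fkWeight s K *
      (Real.exp (s * ((E ∩ edgesOff (vertexCluster o K)).card : ℝ)) *
        pf (edgeCoupling (E ∩ edgesOff (vertexCluster o K)) s)) := by
  classical
  set S := vertexCluster o K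
  have h1 : clusterMass E o s K = ∑ σ, (∏ e ∈ K, fkFactor (edgeCoupling E s) σ e) *
      (Real.exp (s * ((E ∩ edgesOff S).card : ℝ)) * boltz (edgeCoupling (E ∩ edgesOff S) s) σ) := by
    have : ∀ σ : V → ℤˣ, (∏ e ∈ K, fkFactor (edgeCoupling E s) σ e) *
      (Real.exp (s * ((E ∩ edgesOff S).card : ℝ)) *
        boltz (edgeCoupling (E ∩ edgesOff S) s) σ) =
      ∑ ω with edgeCluster o ω = K, ∏ e ∈ ω, fkFactor (edgeCoupling E s) σ e := fun σ => by
      rw [sum_prod_of_edgeCluster_eq hK, prod_one_add_fkFactor]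
    simp only [this]
    rw [Finset.sum_comm, clusterMass]
    refine (Finset.sum_congr rfl fun ω hω => (sum_prod_fkFactor s
      (Finset.mem_powerset.1 (Finset.mem_filter.1 hω).1)).symm).trans
      (Finset.sum_subset (Finset.filter_subset_filter _ (Finset.subset_univ _)) ?_)
    intro ω hω hω'
    refine Finset.sum_eq_zero fun σ _ => prod_fkFactor_eq_zero s (fun hωE => hω' ?_) σ
    exact Finset.mem_filter.2 ⟨Finset.mem_powerset.2 hωE, (Finset.mem_filter.1 hω).2⟩
  rw [h1, ← sum_prod_fkFactor s hKE, pf, Finset.mul_sum Finset.univ (boltz _)]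
  refine card_mul_sum_mul_of_dependsOn (α := ℤˣ) S ?_ ?_
  · intro σ τ h
    refine Finset.prod_congr rfl fun e he => ?_
    rw [fkFactor, fkFactor,
      bond_congr fun x hx => h x (mem_vertexCluster_of_mem_cluster hK he hx)]
  · intro σ τ h
    simp only
    congr 1
    rw [boltz, boltz]
    congr 1
    refine Finset.sum_congr rfl fun e _ => ?_
    by_cases he : e ∈ edgesOff S
    · rw [bond_congr fun x hx => h x (mem_edgesOff.1 he x hx)]
    · simp [edgeCoupling, he]

lemma sum_fkWeight (E : Finset (Sym2 V)) (s : ℝ) :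
    ∑ ω ∈ E.powerset, fkWeight s ω = Real.exp (s * (E.card : ℝ)) * pf (edgeCoupling E s) := by
  have h : ∑ ω ∈ E.powerset, fkWeight s ω =
      ∑ σ, ∏ e ∈ E, (1 + fkFactor (edgeCoupling E s) σ e) := by
    simp only [Finset.prod_one_add]
    rw [Finset.sum_comm]
    exact Finset.sum_congr rfl fun ω hω => (sum_prod_fkFactor s (Finset.mem_powerset.1 hω)).symm
  rw [h, pf, Finset.mul_sum]
  exact Finset.sum_congr rfl fun σ _ => by rw [prod_one_add_fkFactor, Finset.inter_self]

open Classical in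
/-- The possible edge clusters of `o`. -/
def clusters (E : Finset (Sym2 V)) (o : V) : Finset (Finset (Sym2 V)) :=
  {K ∈ E.powerset | edgeCluster o K = K}

lemma mem_clusters {E K : Finset (Sym2 V)} {o : V} :
    K ∈ clusters E o ↔ K ⊆ E ∧ edgeCluster o K = K := by
  simp [clusters]

/-- The probability that the edge cluster of `o` is `K`. -/
def clusterProb (E : Finset (Sym2 V)) (o : V) (s : ℝ) (K : Finset (Sym2 V)) : ℝ :=
  clusterMass E o s K / ∑ ω ∈ E.powerset, fkWeight s ω

lemma fkExp_edgeCluster (G : SimpleGraph V) [DecidableRel G.Adj] (o : V) (s : ℝ)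
    (h : Finset (Sym2 V) → ℝ) :
    fkExp G s (fun ω => h (edgeCluster o ω)) =
      ∑ K ∈ clusters G.edgeFinset o, h K * clusterProb G.edgeFinset o s K := by
  classical
  have hmaps : ∀ ω ∈ G.edgeFinset.powerset, edgeCluster o ω ∈ clusters G.edgeFinset o := by
    intro ω hω
    refine mem_clusters.2 ⟨fun e he => ?_, edgeCluster_edgeCluster o ω⟩
    exact Finset.mem_powerset.1 hω (mem_edgeCluster.1 he).1
  rw [fkExp, ← Finset.sum_fiberwise_of_maps_to hmaps, Finset.sum_div]
  refine Finset.sum_congr rfl fun K _ => ?_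
  rw [clusterProb, clusterMass, ← mul_div_assoc, Finset.mul_sum]
  congr 1
  exact Finset.sum_congr rfl fun ω hω => by rw [(Finset.mem_filter.1 hω).2]

lemma fkWeight_pos {s : ℝ} (hs : 0 < s) (ω : Finset (Sym2 V)) : 0 < fkWeight s ω := by
  have : 0 < Real.exp (2 * s) - 1 := sub_pos.2 (Real.one_lt_exp_iff.2 (by linarith))
  rw [fkWeight]
  positivity

lemma clusterProb_pos {E K : Finset (Sym2 V)} {o : V} (hK : K ∈ clusters E o) {s : ℝ}
    (hs : 0 < s) : 0 < clusterProb E o s K := by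
  classical
  obtain ⟨hKE, hK⟩ := mem_clusters.1 hK
  refine div_pos (Finset.sum_pos (fun ω _ => fkWeight_pos hs ω) ⟨K, ?_⟩)
    (Finset.sum_pos (fun ω _ => fkWeight_pos hs ω) ⟨K, Finset.mem_powerset.2 hKE⟩)
  exact Finset.mem_filter.2 ⟨Finset.mem_powerset.2 hKE, hK⟩

/-- The edges not touching the cluster `K`. -/
def remaining (E : Finset (Sym2 V)) (o : V) (K : Finset (Sym2 V)) : Finset (Sym2 V) :=
  E ∩ edgesOff (vertexCluster o K)

lemma log_clusterProb {E K : Finset (Sym2 V)} {o : V} (hK : K ∈ clusters E o) :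
    ∃ c : ℝ, ∀ s : ℝ, 0 < s → Real.log (clusterProb E o s K) =
      c + (K.card * (s + Real.log (Real.sinh s)) +
        s * (((remaining E o K).card : ℝ) - E.card) +
        (Real.log (pf (edgeCoupling (remaining E o K) s)) - Real.log (pf (edgeCoupling E s)))) := by
  obtain ⟨hKE, hK⟩ := mem_clusters.1 hK
  refine ⟨Nat.card (openGraph K).ConnectedComponent * Real.log 2 + K.card * Real.log 2 -
    Real.log (Fintype.card (V → ℤˣ)), fun s hs => ?_⟩
  have hN : (Fintype.card (V → ℤˣ) : ℝ) ≠ 0 := by positivity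
  have hmass : clusterMass E o s K = fkWeight s K *
      (Real.exp (s * ((remaining E o K).card : ℝ)) * pf (edgeCoupling (remaining E o K) s)) /
        Fintype.card (V → ℤˣ) := by
    rw [eq_div_iff hN, mul_comm]
    exact card_mul_clusterMass hK hKE s
  have hsinh : 0 < Real.sinh s := Real.sinh_pos_iff.2 hs
  -- In this form the logarithm of the edge weight has second derivative `-1 / sinh² s`.
  have hexp : Real.exp (2 * s) - 1 = 2 * (Real.exp s * Real.sinh s) := by
    rw [Real.sinh_eq, two_mul s, Real.exp_add, Real.exp_neg]
    field_simp
  have hw := (fkWeight_pos hs K).ne'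
  have hp1 := (pf_pos (edgeCoupling (remaining E o K) s)).ne'
  have hp2 := (pf_pos (edgeCoupling E s)).ne'
  have he := fun x => (Real.exp_pos x).ne'
  have hwlog : Real.log (fkWeight s K) = Nat.card (openGraph K).ConnectedComponent * Real.log 2 +
      K.card * (Real.log 2 + (s + Real.log (Real.sinh s))) := by
    rw [fkWeight, hexp, Real.log_mul (by positivity) (by positivity), Real.log_pow, Real.log_pow,
      Real.log_mul two_ne_zero (by positivity), Real.log_mul (he s) hsinh.ne', Real.log_exp]
  rw [clusterProb, hmass, sum_fkWeight, Real.log_div, Real.log_div, Real.log_mul, Real.log_mul,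
    Real.log_mul, hwlog, Real.log_exp, Real.log_exp]
  · ring
  all_goals first | exact hN | positivity

end EdwardsSokal

/-! ### Relative entropy of the cluster laws and stability on a finite graph. -/

section RelativeEntropy

variable {V : Type*} [Fintype V] [DecidableEq V]

/-- Mean energy `⟨∑_{e ∈ E} σ_e⟩`. -/
def energyMean (E : Finset (Sym2 V)) (s : ℝ) : ℝ :=
  ∑ e ∈ E, av (edgeCoupling E s) fun σ => bond σ e

lemma edgeCoupling_eq_smul (E : Finset (Sym2 V)) (s : ℝ) :
    edgeCoupling E s = 0 + s • edgeCoupling E 1 := by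
  ext e
  simp [edgeCoupling]

lemma sum_edgeCoupling_one_mul (E : Finset (Sym2 V)) (φ : Sym2 V → ℝ) :
    ∑ e, edgeCoupling E 1 e * φ e = ∑ e ∈ E, φ e := by
  simp [edgeCoupling, Finset.sum_ite_mem]

lemma hasDerivAt_log_pf_edgeCoupling (E : Finset (Sym2 V)) (s : ℝ) :
    HasDerivAt (fun s => Real.log (pf (edgeCoupling E s))) (energyMean E s) s := by
  have h := hasDerivAt_log_pf 0 (edgeCoupling E 1) s
  simp only [← edgeCoupling_eq_smul, sum_edgeCoupling_one_mul] at h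
  exact h

lemma hasDerivAt_energyMean (E : Finset (Sym2 V)) (s : ℝ) :
    HasDerivAt (energyMean E) (energyVar E s) s := by
  have h := HasDerivAt.fun_sum (u := E) fun e (_ : e ∈ E) =>
    hasDerivAt_av 0 (edgeCoupling E 1) (fun σ => bond σ e) s
  simp only [← edgeCoupling_eq_smul, sum_edgeCoupling_one_mul] at h
  exact h

/-- The logarithm of the probability of the cluster `K`, up to an additive constant. -/
def logProfile (E : Finset (Sym2 V)) (o : V) (K : Finset (Sym2 V)) (s : ℝ) : ℝ :=
  K.card * (s + Real.log (Real.sinh s)) + s * (((remaining E o K).card : ℝ) - E.card) +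
    (Real.log (pf (edgeCoupling (remaining E o K) s)) - Real.log (pf (edgeCoupling E s)))

/-- The derivative of `logProfile`. -/
def logProfileDeriv (E : Finset (Sym2 V)) (o : V) (K : Finset (Sym2 V)) (s : ℝ) : ℝ :=
  K.card * (1 + Real.cosh s / Real.sinh s) + (((remaining E o K).card : ℝ) - E.card) +
    (energyMean (remaining E o K) s - energyMean E s)

lemma hasDerivAt_logProfile (E : Finset (Sym2 V)) (o : V) (K : Finset (Sym2 V)) {s : ℝ}
    (hs : 0 < s) : HasDerivAt (logProfile E o K) (logProfileDeriv E o K s) s := by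
  have hsinh := (Real.sinh_pos_iff.2 hs).ne'
  have h1 := ((hasDerivAt_id s).add ((Real.hasDerivAt_sinh s).log hsinh)).const_mul (K.card : ℝ)
  have h2 := (hasDerivAt_id s).mul_const (((remaining E o K).card : ℝ) - E.card)
  have h3 := (hasDerivAt_log_pf_edgeCoupling (remaining E o K) s).sub
    (hasDerivAt_log_pf_edgeCoupling E s)
  refine ((h1.add h2).add h3).congr_deriv ?_
  simp [logProfileDeriv]

lemma hasDerivAt_logProfileDeriv (E : Finset (Sym2 V)) (o : V) (K : Finset (Sym2 V)) {s : ℝ}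
    (hs : 0 < s) : HasDerivAt (logProfileDeriv E o K)
      (-(K.card / Real.sinh s ^ 2 + (energyVar E s - energyVar (remaining E o K) s))) s := by
  have hsinh := (Real.sinh_pos_iff.2 hs).ne'
  have h1 := (((Real.hasDerivAt_cosh s).div (Real.hasDerivAt_sinh s) hsinh).const_add
    1).const_mul (K.card : ℝ)
  have h3 := (hasDerivAt_energyMean (remaining E o K) s).sub (hasDerivAt_energyMean E s)
  refine ((h1.add_const (((remaining E o K).card : ℝ) - E.card)).add h3).congr_deriv ?_
  have : Real.sinh s * Real.sinh s - Real.cosh s * Real.cosh s = -1 := by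
    have := Real.cosh_sq s
    linarith
  rw [this]
  ring

lemma log_clusterProb_eq {E K : Finset (Sym2 V)} {o : V} (hK : K ∈ clusters E o) :
    ∃ c : ℝ, ∀ s : ℝ, 0 < s → Real.log (clusterProb E o s K) = c + logProfile E o K s :=
  log_clusterProb hK

lemma hasDerivAt_clusterProb {E K : Finset (Sym2 V)} {o : V} (hK : K ∈ clusters E o) {s : ℝ}
    (hs : 0 < s) : HasDerivAt (fun s => clusterProb E o s K)
      (clusterProb E o s K * logProfileDeriv E o K s) s := by
  obtain ⟨c, hc⟩ := log_clusterProb_eq hK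
  have hexp : ∀ t : ℝ, 0 < t → clusterProb E o t K = Real.exp (c + logProfile E o K t) :=
    fun t ht => by rw [← hc t ht, Real.exp_log (clusterProb_pos hK ht)]
  rw [hexp s hs]
  refine (((hasDerivAt_logProfile E o K hs).const_add c).exp).congr_of_eventuallyEq ?_
  filter_upwards [lt_mem_nhds hs] with t ht using hexp t ht

variable (G : SimpleGraph V) [DecidableRel G.Adj] (o : V)

lemma sum_clusterProb {s : ℝ} (hs : 0 < s) :
    ∑ K ∈ clusters G.edgeFinset o, clusterProb G.edgeFinset o s K = 1 := by
  have h := fkExp_edgeCluster G o s fun _ => 1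
  simp only [one_mul] at h
  rw [← h, fkExp]
  simp only [one_mul]
  exact div_self (Finset.sum_pos (fun ω _ => fkWeight_pos hs ω)
    ⟨∅, Finset.empty_mem_powerset _⟩).ne'

/-- The score has mean zero: the probabilities sum to `1` for all positive `s`, so their derivatives
sum to `0`. -/
lemma sum_clusterProb_mul_deriv {s : ℝ} (hs : 0 < s) :
    ∑ K ∈ clusters G.edgeFinset o,
      clusterProb G.edgeFinset o s K * logProfileDeriv G.edgeFinset o K s = 0 := by
  have h1 := HasDerivAt.fun_sum (u := clusters G.edgeFinset o) fun K hK =>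
    hasDerivAt_clusterProb hK hs
  have h2 : HasDerivAt
      (fun s => ∑ K ∈ clusters G.edgeFinset o, clusterProb G.edgeFinset o s K) 0 s := by
    refine (hasDerivAt_const s (1 : ℝ)).congr_of_eventuallyEq ?_
    filter_upwards [lt_mem_nhds hs] with t ht using sum_clusterProb G o ht
  exact h1.unique h2

/-- The relative entropy between the cluster laws at two temperatures is quadratic in their
difference. -/
lemma relativeEntropy_le {a b M : ℝ} (ha : 0 < a) (hab : a ≤ b)
    (hM : ∀ K ∈ clusters G.edgeFinset o, ∀ s ∈ Set.Icc a b,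
      K.card / Real.sinh s ^ 2 + (energyVar G.edgeFinset s -
        energyVar (remaining G.edgeFinset o K) s) ≤ M * (vertexCluster o K).ncard) :
    ∑ K ∈ clusters G.edgeFinset o, clusterProb G.edgeFinset o a K *
        Real.log (clusterProb G.edgeFinset o a K / clusterProb G.edgeFinset o b K) ≤
      M / 2 * (b - a) ^ 2 * ∑ K ∈ clusters G.edgeFinset o,
        ((vertexCluster o K).ncard : ℝ) * clusterProb G.edgeFinset o a K := by
  set E := G.edgeFinset
  have hb : 0 < b := ha.trans_le hab
  have hterm : ∀ K ∈ clusters E o, clusterProb E o a K *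
      Real.log (clusterProb E o a K / clusterProb E o b K) ≤
      -(b - a) * (clusterProb E o a K * logProfileDeriv E o K a) +
        M / 2 * (b - a) ^ 2 * (((vertexCluster o K).ncard : ℝ) * clusterProb E o a K) := by
    intro K hK
    have hpa := clusterProb_pos hK ha
    have hpb := clusterProb_pos hK hb
    obtain ⟨c, hc⟩ := log_clusterProb_eq hK
    have hT := taylor_lower_bound hab
      (fun s hs => hasDerivAt_logProfile E o K (ha.trans_le hs.1))
      (fun s hs => hasDerivAt_logProfileDeriv E o K (ha.trans_le hs.1))
      (fun s hs => neg_le_neg (hM K hK s hs))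
    rw [Real.log_div hpa.ne' hpb.ne', hc a ha, hc b hb]
    have : c + logProfile E o K a - (c + logProfile E o K b) ≤
        -(b - a) * logProfileDeriv E o K a +
          M * (vertexCluster o K).ncard / 2 * (b - a) ^ 2 := by linarith
    exact (mul_le_mul_of_nonneg_left this hpa.le).trans_eq (by ring)
  refine (Finset.sum_le_sum hterm).trans_eq ?_
  rw [Finset.sum_add_distrib, ← Finset.mul_sum, ← Finset.mul_sum,
    sum_clusterProb_mul_deriv G o ha, mul_zero, zero_add]

/-- Stability of cluster events under a change of temperature, on a general finite graph. -/
theorem abs_fkProb_sub_le {b q Δ T : ℝ} (hb : 0 < b) (hq : 0 ≤ q) (hT1 : 1 ≤ T)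
    (hΔ : ∀ x, (({e ∈ G.edgeFinset | x ∈ e} : Finset (Sym2 V)).card : ℝ) ≤ Δ)
    (hcomp : Comparable G.edgeFinset (corr (edgeCoupling G.edgeFinset b)) q)
    (hT : ∀ u, ∑ x, ∑ z, corr (edgeCoupling G.edgeFinset b) u x *
      corr (edgeCoupling G.edgeFinset b) x z * corr (edgeCoupling G.edgeFinset b) z u ≤ T)
    (B : Set (Finset (Sym2 V))) {β β' : ℝ} (h1 : b / 2 ≤ β') (h2 : β' < β) (h3 : β ≤ b) :
    |fkProb G β (edgeCluster o ⁻¹' B) - fkProb G β' (edgeCluster o ⁻¹' B)| ≤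
      Real.sqrt (2 * (4 * Δ / b ^ 2 + (4 * q ^ 4 * Δ ^ 2 + 12 * q ^ 6 * b * Δ ^ 3))) *
        |β - β'| * Real.sqrt (T * max (fkProb G β (edgeCluster o ⁻¹' B))
          (fkProb G β' (edgeCluster o ⁻¹' B)) *
          fkExp G β' fun ω => ((vertexCluster o ω).ncard : ℝ)) := by
  classical
  set E := G.edgeFinset with hE
  set m := 4 * Δ / b ^ 2 + (4 * q ^ 4 * Δ ^ 2 + 12 * q ^ 6 * b * Δ ^ 3) with hm
  have hβ' : 0 < β' := by linarith
  have hβ : 0 < β := hβ'.trans h2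
  have hΔ0 : 0 ≤ Δ := (Nat.cast_nonneg _).trans (hΔ o)
  have hprob : ∀ s, fkProb G s (edgeCluster o ⁻¹' B) =
      ∑ K ∈ clusters E o with K ∈ B, clusterProb E o s K := by
    intro s
    have h := fkExp_edgeCluster G o s (B.indicator 1)
    rw [Finset.sum_filter]
    refine h.trans (Finset.sum_congr rfl fun K _ => ?_)
    by_cases hK : K ∈ B <;> simp [hK, hE]
  have hχ : fkExp G β' (fun ω => ((vertexCluster o ω).ncard : ℝ)) =
      ∑ K ∈ clusters E o, ((vertexCluster o K).ncard : ℝ) * clusterProb E o β' K := by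
    rw [← fkExp_edgeCluster G o β' fun K => ((vertexCluster o K).ncard : ℝ)]
    simp only [vertexCluster_edgeCluster]
  have hM : ∀ K ∈ clusters E o, ∀ s ∈ Set.Icc β' β,
      K.card / Real.sinh s ^ 2 + (energyVar E s - energyVar (remaining E o K) s) ≤
        (m * T) * (vertexCluster o K).ncard := by
    intro K hK s hs
    obtain ⟨hKE, hKK⟩ := mem_clusters.1 hK
    have hs0 : 0 < s := hβ'.trans_le hs.1
    set n : ℝ := ((vertexCluster o K).ncard : ℝ) with hn
    have hn0 : 0 ≤ n := Nat.cast_nonneg _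
    have hv : energyVar E s - energyVar (remaining E o K) s ≤
        (4 * q ^ 4 * Δ ^ 2 + 12 * q ^ 6 * b * Δ ^ 3) * T * n := by
      refine energyVar_sub_le hs0.le (hs.2.trans h3) hq Finset.inter_subset_left ?_ hΔ hcomp hT
      intro e he
      rw [remaining, Finset.sdiff_inter_self_left, Finset.mem_sdiff, mem_edgesOff] at he
      simpa using he.2
    have hcard : (K.card : ℝ) ≤ Δ * n := by
      refine card_touching_le hΔ hKE fun e he => ?_
      rw [← hKK, mem_edgeCluster] at he
      exact he.2
    -- Only here is the lower bound `b / 2` on the temperature range needed quantitatively, through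
    -- `sinh s ≥ s`.
    have hsinh : b ^ 2 / 4 ≤ Real.sinh s ^ 2 := by
      have : b / 2 ≤ Real.sinh s := (h1.trans hs.1).trans (Real.self_le_sinh_iff.2 hs0.le)
      calc b ^ 2 / 4 = (b / 2) ^ 2 := by ring
        _ ≤ _ := by gcongr
    -- `1 ≤ T` lets the edge-count term be absorbed into the triangle factor.
    have hK1 : K.card / Real.sinh s ^ 2 ≤ 4 * Δ / b ^ 2 * T * n := by
      calc (K.card : ℝ) / Real.sinh s ^ 2 ≤ Δ * n / (b ^ 2 / 4) := by gcongr
        _ = 4 * Δ / b ^ 2 * 1 * n := by field_simp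
        _ ≤ _ := by gcongr
    calc _ ≤ _ := add_le_add hK1 hv
      _ = _ := by rw [hm]; ring
  have hKL := relativeEntropy_le G o hβ' h2.le hM
  have hP := sq_sub_le_entropy (clusters E o) {K ∈ clusters E o | K ∈ B}
    (Finset.filter_subset _ _) (fun K hK => clusterProb_pos hK hβ)
    (fun K hK => clusterProb_pos hK hβ')
    ((sum_clusterProb G o hβ).trans (sum_clusterProb G o hβ').symm)
  rw [← hprob, ← hprob] at hP
  rw [← hχ] at hKL
  set P := fkProb G β (edgeCluster o ⁻¹' B)
  set P' := fkProb G β' (edgeCluster o ⁻¹' B)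
  set χ := fkExp G β' fun ω => ((vertexCluster o ω).ncard : ℝ)
  have hP0 : 0 ≤ P := by
    rw [show P = _ from hprob β]
    exact Finset.sum_nonneg fun K hK => (clusterProb_pos (Finset.mem_filter.1 hK).1 hβ).le
  have hmax : 0 ≤ 4 * max P P' := mul_nonneg (by norm_num) (hP0.trans (le_max_left _ _))
  have hm0 : 0 ≤ m := by positivity
  -- The factor `2` is the `4` of the Pinsker bound times the `1/2` of the Taylor bound.
  have hsq : (P - P') ^ 2 ≤ 2 * m * |β - β'| ^ 2 * (T * max P P' * χ) := by
    refine hP.trans ((mul_le_mul_of_nonneg_left hKL hmax).trans_eq ?_)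
    rw [sq_abs]
    ring
  refine (Real.abs_le_sqrt hsq).trans_eq ?_
  rw [Real.sqrt_mul (by positivity), Real.sqrt_mul (by positivity),
    Real.sqrt_sq (abs_nonneg _)]

end RelativeEntropy

/-! ### Degree, comparability and triangle bounds on the lattice. -/

section LatticeBounds

variable {d : ℕ}

lemma twoPoint_eq_corr (Λ : Finset (Fin d → ℤ)) (β : ℝ) (x y : Λ) :
    twoPoint Λ β x y = corr (edgeCoupling (volumeGraph Λ).edgeFinset β) x y := by
  have h : ∀ σ : Λ → ℤˣ, isingWeight (volumeGraph Λ) (fun _ => β) 0 σ =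
      boltz (edgeCoupling (volumeGraph Λ).edgeFinset β) σ := by
    intro σ
    simp only [isingWeight, boltz, edgeCoupling, ite_mul, zero_mul, Finset.sum_ite_mem,
      Finset.univ_inter, Pi.zero_apply, Finset.sum_const_zero, add_zero, bond]
  simp only [twoPoint, isingExp, corr, av, pf, h, spin, Units.val_mul, Int.cast_mul]

lemma card_incident_le (Λ : Finset (Fin d → ℤ)) (x : Λ) :
    ((({e ∈ (volumeGraph Λ).edgeFinset | x ∈ e} : Finset (Sym2 Λ)).card : ℕ) : ℝ) ≤ 3 ^ d := by
  have h1 : ({e ∈ (volumeGraph Λ).edgeFinset | x ∈ e} : Finset (Sym2 Λ)) =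
      (volumeGraph Λ).incidenceFinset x := by
    ext e
    simp [SimpleGraph.incidenceSet]
  rw [h1, SimpleGraph.card_incidenceFinset_eq_degree, ← SimpleGraph.card_neighborFinset_eq_degree]
  have h2 : ((volumeGraph Λ).neighborFinset x).card ≤
      (Fintype.piFinset fun _ : Fin d => Finset.Icc (-1 : ℤ) 1).card := by
    -- Neighbours are placed in the cube `{-1, 0, 1}^d`; the crude degree bound `3^d` suffices for a
    -- constant depending on `d`.
    refine Finset.card_le_card_of_injOn (fun y => y.1 - x.1) ?_ ?_
    · intro y hy
      have hadj : ∑ i, (x.1 i - y.1 i) ^ 2 = 1 := by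
        have := (SimpleGraph.mem_neighborFinset _ _ _).1 (Finset.mem_coe.1 hy)
        exact this
      refine Finset.mem_coe.2 (Fintype.mem_piFinset.2 fun i => ?_)
      have hi : (x.1 i - y.1 i) ^ 2 ≤ 1 := by
        rw [← hadj]
        exact Finset.single_le_sum (f := fun i => (x.1 i - y.1 i) ^ 2)
          (fun j _ => sq_nonneg _) (Finset.mem_univ i)
      have := abs_le.1 ((sq_le_one_iff_abs_le_one _).1 hi)
      simp only [Pi.sub_apply, Finset.mem_Icc]
      constructor <;> linarith [this.1, this.2]
    · intro y _ z _ h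
      exact Subtype.ext (sub_left_injective h)
  have h3 : (Fintype.piFinset fun _ : Fin d => Finset.Icc (-1 : ℤ) 1).card = 3 ^ d := by simp
  rw [h3] at h2
  exact_mod_cast h2

/-- Griffiths gives `⟨σ_y σ_x⟩ ⟨σ_x σ_z⟩ ≤ ⟨σ_y σ_z⟩`, and the first factor is at least `tanh b` for
endpoints of an edge. -/
lemma comparable_corr {V : Type*} [Fintype V] [DecidableEq V] (E : Finset (Sym2 V)) {b : ℝ}
    (hb : 0 < b) : Comparable E (corr (edgeCoupling E b)) (Real.tanh b)⁻¹ where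
  symm := corr_comm _
  nonneg := corr_nonneg (edgeCoupling_nonneg E hb.le)
  le := by
    intro e he x hx y hy z
    have hJ := edgeCoupling_nonneg E hb.le
    have ht : 0 < Real.tanh b := by
      rw [Real.tanh_eq_sinh_div_cosh]
      exact div_pos (Real.sinh_pos_iff.2 hb) (Real.cosh_pos b)
    have h1 : Real.tanh b ≤ corr (edgeCoupling E b) y x := by
      by_cases hxy : y = x
      · rw [hxy, corr_self]
        exact (Real.tanh_lt_one b).le
      · have := tanh_le_corr hJ hxy
        have he' : e = s(y, x) := (Sym2.mem_and_mem_iff hxy).1 ⟨hy, hx⟩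
        rwa [edgeCoupling, if_pos (he' ▸ he)] at this
    rw [inv_mul_eq_div, le_div_iff₀ ht, mul_comm]
    exact (mul_le_mul_of_nonneg_right h1 (corr_nonneg hJ x z)).trans (corr_mul_corr_le hJ y x z)

lemma sum_le_triangle (Λ : Finset (Fin d → ℤ)) (β : ℝ) (u : Λ) :
    ∑ x, ∑ z, corr (edgeCoupling (volumeGraph Λ).edgeFinset β) u x *
      corr (edgeCoupling (volumeGraph Λ).edgeFinset β) x z *
      corr (edgeCoupling (volumeGraph Λ).edgeFinset β) z u ≤ triangle Λ β := by
  simp only [← twoPoint_eq_corr]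
  exact le_ciSup (f := fun x : Λ => ∑ y : Λ, ∑ z : Λ,
    twoPoint Λ β x y * twoPoint Λ β y z * twoPoint Λ β z x) (Set.finite_range _).bddAbove u

lemma one_le_triangle {Λ : Finset (Fin d → ℤ)} (u : Λ) {β : ℝ} (hβ : 0 ≤ β) :
    1 ≤ triangle Λ β := by
  refine le_trans ?_ (sum_le_triangle Λ β u)
  set τ := corr (edgeCoupling (volumeGraph Λ).edgeFinset β) with hτ
  have hn : ∀ x y, 0 ≤ τ x y := corr_nonneg (edgeCoupling_nonneg _ hβ)
  have hp : ∀ x z, 0 ≤ τ u x * τ x z * τ z u := fun x z =>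
    mul_nonneg (mul_nonneg (hn _ _) (hn _ _)) (hn _ _)
  have h1 : τ u u = 1 := corr_self _ u
  calc (1 : ℝ) = τ u u * τ u u * τ u u := by rw [h1]; norm_num
    _ ≤ ∑ z, τ u u * τ u z * τ z u :=
        Finset.single_le_sum (f := fun z => τ u u * τ u z * τ z u) (fun z _ => hp u z)
          (Finset.mem_univ u)
    _ ≤ _ := Finset.single_le_sum (f := fun x => ∑ z, τ u x * τ x z * τ z u)
          (fun x _ => Finset.sum_nonneg fun z _ => hp x z) (Finset.mem_univ u)

end LatticeBounds

end FKIsing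

end

theorem mainTheorem11 (d : ℕ) (hd : 2 ≤ d) :
    ∃ C : ℝ, 0 < C ∧
      ∀ (Λ : Finset (Fin d → ℤ)) (h0 : 0 ∈ Λ) (A : Set (Finset (Sym2 Λ))),
        MeasurableSet[MeasurableSpace.comap
          (FKIsing.edgeCluster (⟨0, h0⟩ : Λ)) ⊤] A →
        ∀ β β' : ℝ, FKIsing.betaC d / 2 ≤ β' → β' < β → β ≤ FKIsing.betaC d →
          |FKIsing.fkProb (FKIsing.volumeGraph Λ) β A -
              FKIsing.fkProb (FKIsing.volumeGraph Λ) β' A| ≤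
            C * |β - β'| *
              Real.sqrt (FKIsing.triangle Λ (FKIsing.betaC d) *
                max (FKIsing.fkProb (FKIsing.volumeGraph Λ) β A)
                  (FKIsing.fkProb (FKIsing.volumeGraph Λ) β' A) *
                FKIsing.fkExp (FKIsing.volumeGraph Λ) β'
                  (fun ω => ((FKIsing.vertexCluster (⟨0, h0⟩ : Λ) ω).ncard : ℝ))) := by
  set b := FKIsing.betaC d with hbdef
  -- If `b ≤ 0` no pair satisfies `b / 2 ≤ β' < β ≤ b`, so positivity of the critical point need not
  -- be proved.
  rcases le_or_gt b 0 with hb | hb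
  · refine ⟨1, one_pos, fun Λ h0 A _ β β' h1 h2 h3 => ?_⟩
    linarith
  have ht : 0 < Real.tanh b := by
    rw [Real.tanh_eq_sinh_div_cosh]
    exact div_pos (Real.sinh_pos_iff.2 hb) (Real.cosh_pos b)
  refine ⟨Real.sqrt (2 * (4 * 3 ^ d / b ^ 2 + (4 * (Real.tanh b)⁻¹ ^ 4 * (3 ^ d) ^ 2 +
    12 * (Real.tanh b)⁻¹ ^ 6 * b * (3 ^ d) ^ 3))), Real.sqrt_pos.2 (by positivity),
    fun Λ h0 A hA β β' h1 h2 h3 => ?_⟩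
  obtain ⟨B, -, rfl⟩ := hA
  exact FKIsing.abs_fkProb_sub_le (FKIsing.volumeGraph Λ) ⟨0, h0⟩ hb (inv_pos.2 ht).le
    (FKIsing.one_le_triangle ⟨0, h0⟩ hb.le) (FKIsing.card_incident_le Λ)
    (FKIsing.comparable_corr _ hb) (FKIsing.sum_le_triangle Λ b) B h1 h2 h3
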